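/- Let $\mathcal{L}_{RRP}$ be the three-sorted Denef–Pas language with a field sort $K$ and a residue field sort $\overline{K}$, each in the language of rings $\{+,-,\cdot,0,1\}$, a value group sort $\Gamma\cup\{\infty\}$ in the language $\{+,<,0,1,\infty\}\cup\{D_n : n>1\}$ (where $D_n$ means divisibility by $n$), and function symbols $v:K\to\Gamma\cup\{\infty\}$ and $\mathrm{ac}:K\to\overline{K}$. Let $S=\langle K,\overline{K},\Gamma\cup\{\infty\},v,\mathrm{ac}\rangle$ be an $\mathcal{L}_{RRP}$-structure in which $K$ is a field, $v$ is a valuation of $K$ with value group $\Gamma$ and residue field $\overline{K}$, and $\mathrm{ac}$ is an angular component map: $\mathrm{ac}(0)=0$, $\mathrm{ac}$ restricts to a group homomorphism $K^\times\to\overline{K}^\times$, and $\mathrm{ac}(u)$ is the residue of $u$ for every unit $u$ of the valuation ring. Assume that 1. $K$ and $\overline{K}$ have characteristic $0$; 2. $\Gamma$, with the interpretation of the symbol $1$ in $S$, is a $\mathbb{Z}$-group, i.e. it is elementarily equivalent to $\mathbb{Z}$ in the Presburger language $\{+,<,0,1\}\cup\{D_n : n>1\}$; 3. $\mathrm{Th}(S)$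 admits quantifier elimination in the $K$-sort: for every $\mathcal{L}_{RRP}$-formula $\varphi$ there is an $\mathcal{L}_{RRP}$-formula $\varphi^*$ without quantifiers over the $K$-sort such that $S\models\varphi\leftrightarrow\varphi^*$. Then the 2-type in the $K$-sort variables $X,Y$ $$\Phi(X,Y)=\{\,0<v(X^n)<v(Y)\ \wedge\ Y\neq 0 : n\ge 1\,\}$$ is not isolated modulo $\mathrm{Th}(S)$; that is, there is no $\mathcal{L}_{RRP}$-formula $\pi(X,Y)$ such that $S\models\exists X,Y\,\pi(X,Y)$ and $S\models\forall X,Y\,(\pi\to\varphi)$ for every $\varphi\in\Phi$. Moreover, there is an $\mathcal{L}_{RRP}$-structure $S_1=\langle K_1,\overline{K}_1,\Gamma_1\cup\{\infty\},v_1,\mathrm{ac}_1\rangle$, again consisting of a valued field with its value group, its residue field and an angular component map, such that $S_1\equiv S$ and $v_1$ has rank $1$, i.e. $\{0\}$ is the only proper convex subgroup of $\Gamma_1$. -/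

import Mathlib

universe u w

namespace Pas

/-! ### Ordered abelian groups: rank one, and `ℤ`-groups -/

/-- An ordered abelian group has rank one if `{0}` is its only proper convex subgroup. -/
def IsRankOne (G : Type*) [AddCommGroup G] [LinearOrder G] : Prop :=
  {H : AddSubgroup G | (∀ a b : G, b ∈ H → 0 ≤ a → a ≤ b → a ∈ H) ∧ H ≠ ⊤} = {⊥}

/-- Function symbols of the Presburger language: `0`, `1`, `+`. -/
inductive PrFunc : ℕ → Type
  | zero : PrFunc 0
  | one : PrFunc 0
  | add : PrFunc 2

/-- Relation symbols of the Presburger language: `<` and `D_n` for `n > 1`. -/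
inductive PrRel : ℕ → Type
  | lt : PrRel 2
  | dvd (n : ℕ) (hn : 1 < n) : PrRel 1

/-- The Presburger language `{+, <, 0, 1} ∪ {D_n : n > 1}`. -/
def presburgerLanguage : FirstOrder.Language where
  Functions := PrFunc
  Relations := PrRel

/-- An ordered abelian group `G` with a distinguished element `e` as a structure of the
Presburger language: `1` is interpreted as `e` and `D_n` as divisibility by `n`. -/
@[reducible]
def presburgerGroupStructure (G : Type*) [AddCommGroup G] [LinearOrder G] (e : G) :
    presburgerLanguage.Structure G where
  funMap
    | PrFunc.zero, _ => 0
    | PrFunc.one, _ => e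
    | PrFunc.add, x => x 0 + x 1
  RelMap
    | PrRel.lt, x => x 0 < x 1
    | PrRel.dvd n _, x => ∃ y : G, x 0 = n • y

/-- `(G, e)` is a `ℤ`-group: it is elementarily equivalent to `(ℤ, 1)` in the Presburger
language. -/
def IsZGroup (G : Type*) [AddCommGroup G] [LinearOrder G] (e : G) : Prop :=
  @FirstOrder.Language.ElementarilyEquivalent presburgerLanguage G ℤ
    (presburgerGroupStructure G e) (presburgerGroupStructure ℤ 1)

/-! ### Valued fields with an angular component map -/

section
variable {K : Type u} {Γ : Type w} [Field K] [AddCommGroup Γ] [LinearOrder Γ]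
  [IsOrderedAddMonoid Γ]

/-- The valuation ring `{x : v x ≥ 0}`. -/
def valuationRing (v : AddValuation K (WithTop Γ)) : ValuationSubring K where
  carrier := {x | 0 ≤ v x}
  mul_mem' {a b} ha hb := by
    simp only [Set.mem_ofPred_eq, v.map_mul] at *
    exact add_nonneg ha hb
  one_mem' := by simp [v.map_one]
  add_mem' {a b} ha hb := v.map_le_add ha hb
  zero_mem' := by simp [v.map_zero]
  neg_mem' {a} ha := by simpa [v.map_neg] using ha
  mem_or_inv_mem' a := by
    by_cases h : a = 0
    · left; simp [h]
    · simp only [Set.mem_ofPred_eq]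
      have h1 : v a + v a⁻¹ = 0 := by rw [← v.map_mul, mul_inv_cancel₀ h, v.map_one]
      by_contra! hlt
      have h2 : v a + v a⁻¹ ≤ v a + 0 := by gcongr; exact hlt.2.le
      rw [h1, add_zero] at h2
      exact absurd hlt.1 (not_lt.mpr h2)

/-- The residue field of `v`: the valuation ring modulo its maximal ideal. -/
abbrev ResidueField (v : AddValuation K (WithTop Γ)) : Type u :=
  IsLocalRing.ResidueField (valuationRing v)

/-- Angular component maps `K → residue field`. -/
structure IsAngularComponent (v : AddValuation K (WithTop Γ)) (ac : K → ResidueField v) :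
    Prop where
  map_zero : ac 0 = 0
  map_units : ∃ f : Kˣ →* (ResidueField v)ˣ, ∀ x : Kˣ, ac x = f x
  map_residue : ∀ a : valuationRing v, IsUnit a →
    ac a = IsLocalRing.residue (valuationRing v) a

end

/-- A structure `⟨K, residue field, Γ ∪ {∞}, v, ac⟩`, where `v` is a valuation of the field `K`
with value group `Γ`, `ac` is an angular component map, and `one` interprets the constant
symbol `1` of the `Γ`-sort. All other symbols have their standard interpretation. -/
structure PasStructure where
  K : Type u
  Γ : Type w
  [field : Field K]
  [addCommGroup : AddCommGroup Γ]
  [linearOrder : LinearOrder Γ]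
  [isOrderedAddMonoid : IsOrderedAddMonoid Γ]
  v : AddValuation K (WithTop Γ)
  v_surjective : ∀ m : Γ, ∃ x : K, v x = m
  ac : K → ResidueField v
  isAngularComponent : IsAngularComponent v ac
  one : Γ

attribute [instance] PasStructure.field PasStructure.addCommGroup PasStructure.linearOrder
  PasStructure.isOrderedAddMonoid

/-- The residue field sort. -/
abbrev PasStructure.k (S : PasStructure.{u, w}) : Type u := ResidueField S.v

/-- The value group sort `Γ ∪ {∞}`. -/
abbrev PasStructure.Γinf (S : PasStructure.{u, w}) : Type w := WithTop S.Γ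

/-! ### The three-sorted language

`i`, `j`, `l` are the numbers of free variables of the field sort, the residue field sort and
the value group sort. -/

/-- Terms of the field sort, in the language of rings. -/
inductive KTerm (i : ℕ) : Type
  | var (x : Fin i) : KTerm i
  | zero : KTerm i
  | one : KTerm i
  | add (s t : KTerm i) : KTerm i
  | neg (s : KTerm i) : KTerm i
  | mul (s t : KTerm i) : KTerm i

/-- Terms of the residue field sort: the language of rings, together with `ac`. -/
inductive RTerm (i j : ℕ) : Type
  | var (x : Fin j) : RTerm i j
  | zero : RTerm i j
  | one : RTerm i j
  | add (s t : RTerm i j) : RTerm i j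
  | neg (s : RTerm i j) : RTerm i j
  | mul (s t : RTerm i j) : RTerm i j
  | ac (s : KTerm i) : RTerm i j

/-- Terms of the value group sort: `0`, `1`, `∞`, `+`, together with `v`. -/
inductive GTerm (i l : ℕ) : Type
  | var (x : Fin l) : GTerm i l
  | zero : GTerm i l
  | one : GTerm i l
  | infty : GTerm i l
  | add (s t : GTerm i l) : GTerm i l
  | v (s : KTerm i) : GTerm i l

/-- Formulas. Each quantifier binds the last variable of its sort. -/
inductive Formula : ℕ → ℕ → ℕ → Type
  | falsum {i j l : ℕ} : Formula i j l
  | eqK {i j l : ℕ} (s t : KTerm i) : Formula i j l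
  | eqR {i j l : ℕ} (s t : RTerm i j) : Formula i j l
  | eqG {i j l : ℕ} (s t : GTerm i l) : Formula i j l
  | lt {i j l : ℕ} (s t : GTerm i l) : Formula i j l
  | dvd {i j l : ℕ} (n : ℕ) (hn : 1 < n) (s : GTerm i l) : Formula i j l
  | imp {i j l : ℕ} (φ ψ : Formula i j l) : Formula i j l
  | allK {i j l : ℕ} (φ : Formula (i + 1) j l) : Formula i j l
  | allR {i j l : ℕ} (φ : Formula i (j + 1) l) : Formula i j l
  | allG {i j l : ℕ} (φ : Formula i j (l + 1)) : Formula i j l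

/-- Negation. -/
def Formula.not {i j l : ℕ} (φ : Formula i j l) : Formula i j l := φ.imp Formula.falsum

/-- Conjunction. -/
def Formula.and {i j l : ℕ} (φ ψ : Formula i j l) : Formula i j l := (φ.imp ψ.not).not

/-- A formula is simple if it contains no quantifier over the field sort. -/
def Formula.IsSimple : {i j l : ℕ} → Formula i j l → Prop
  | _, _, _, .falsum => True
  | _, _, _, .eqK _ _ => True
  | _, _, _, .eqR _ _ => True
  | _, _, _, .eqG _ _ => True
  | _, _, _, .lt _ _ => True
  | _, _, _, .dvd _ _ _ => True
  | _, _, _, .imp φ ψ => φ.IsSimple ∧ ψ.IsSimple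
  | _, _, _, .allK _ => False
  | _, _, _, .allR φ => φ.IsSimple
  | _, _, _, .allG φ => φ.IsSimple

/-! ### Semantics -/

/-- Value of a term of the field sort. -/
def KTerm.eval (S : PasStructure.{u, w}) {i : ℕ} (x : Fin i → S.K) : KTerm i → S.K
  | .var a => x a
  | .zero => 0
  | .one => 1
  | .add s t => s.eval S x + t.eval S x
  | .neg s => - s.eval S x
  | .mul s t => s.eval S x * t.eval S x

/-- Value of a term of the residue field sort. -/
noncomputable def RTerm.eval (S : PasStructure.{u, w}) {i j : ℕ} (x : Fin i → S.K)
    (y : Fin j → S.k) : RTerm i j → S.k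
  | .var a => y a
  | .zero => 0
  | .one => 1
  | .add s t => s.eval S x y + t.eval S x y
  | .neg s => - s.eval S x y
  | .mul s t => s.eval S x y * t.eval S x y
  | .ac s => S.ac (s.eval S x)

/-- Value of a term of the value group sort; `m + ∞ = ∞ + m = ∞`. -/
def GTerm.eval (S : PasStructure.{u, w}) {i l : ℕ} (x : Fin i → S.K)
    (z : Fin l → S.Γinf) : GTerm i l → S.Γinf
  | .var a => z a
  | .zero => 0
  | .one => (S.one : S.Γinf)
  | .infty => ⊤
  | .add s t => s.eval S x z + t.eval S x z
  | .v s => S.v (s.eval S x)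

/-- Satisfaction of a formula in `S`. -/
def Formula.Realize (S : PasStructure.{u, w}) : {i j l : ℕ} → Formula i j l →
    (Fin i → S.K) → (Fin j → S.k) → (Fin l → S.Γinf) → Prop
  | _, _, _, .falsum, _, _, _ => False
  | _, _, _, .eqK s t, x, _, _ => s.eval S x = t.eval S x
  | _, _, _, .eqR s t, x, y, _ => s.eval S x y = t.eval S x y
  | _, _, _, .eqG s t, x, _, z => s.eval S x z = t.eval S x z
  | _, _, _, .lt s t, x, _, z => s.eval S x z < t.eval S x z
  | _, _, _, .dvd n _ s, x, _, z => ∃ m : S.Γinf, s.eval S x z = n • m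
  | _, _, _, .imp φ ψ, x, y, z => φ.Realize S x y z → ψ.Realize S x y z
  | _, _, _, .allK φ, x, y, z => ∀ a : S.K, φ.Realize S (Fin.snoc x a) y z
  | _, _, _, .allR φ, x, y, z => ∀ b : S.k, φ.Realize S x (Fin.snoc y b) z
  | _, _, _, .allG φ, x, y, z => ∀ c : S.Γinf, φ.Realize S x y (Fin.snoc z c)

/-- The theory of `S` admits quantifier elimination in the field sort. -/
def PasStructure.AdmitsQEInFieldSort (S : PasStructure.{u, w}) : Prop :=
  ∀ (i j l : ℕ) (φ : Formula i j l), ∃ ψ : Formula i j l, ψ.IsSimple ∧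
    ∀ (x : Fin i → S.K) (y : Fin j → S.k) (z : Fin l → S.Γinf),
      φ.Realize S x y z ↔ ψ.Realize S x y z

/-- Elementary equivalence: `S` and `T` satisfy the same sentences. -/
def PasStructure.ElementarilyEquivalent (S T : PasStructure.{u, w}) : Prop :=
  ∀ φ : Formula 0 0 0, φ.Realize S ![] ![] ![] ↔ φ.Realize T ![] ![] ![]

/-- A set `p` of formulas is isolated modulo the theory of `S`: some formula `π` that is
satisfiable in `S` implies in `S` every formula in `p`. -/
def PasStructure.IsIsolated (S : PasStructure.{u, w}) {i j l : ℕ} (p : Set (Formula i j l)) :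
    Prop :=
  ∃ π : Formula i j l, (∃ x y z, π.Realize S x y z) ∧
    ∀ φ ∈ p, ∀ x y z, π.Realize S x y z → φ.Realize S x y z

/-- Powers of a term of the field sort. -/
def KTerm.pow {i : ℕ} (s : KTerm i) : ℕ → KTerm i
  | 0 => .one
  | n + 1 => .mul (s.pow n) s

/-- The formula `0 < v(X ^ n) ∧ v(X ^ n) < v(Y) ∧ Y ≠ 0`, where `X`, `Y` are the two variables
of the field sort. -/
def gapFormula (n : ℕ) : Formula 2 0 0 :=
  ((Formula.lt .zero (.v (KTerm.pow (.var 0) n))).and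
    (Formula.lt (.v (KTerm.pow (.var 0) n)) (.v (.var 1)))).and
    (Formula.eqK (.var 1) .zero).not

/-- The type `{0 < v(X ^ n) < v(Y) ∧ Y ≠ 0 : n ≥ 1}`. -/
def gapType : Set (Formula 2 0 0) := {φ | ∃ n : ℕ, 1 ≤ n ∧ φ = gapFormula n}

end Pas

/-! Non-isolation. By quantifier elimination, an isolating formula may be taken without field
quantifiers. In residue characteristic zero, a nonzero polynomial in `X, Y` behaves like a single
monomial wherever `v(X) > 0` and `v(Y)` exceeds a suitable multiple of `v(X)`: both its value and
its angular component are those of the monomial (`eval_eq_zero_or`). A simple formula therefore sees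
`y` only through `ac y` and `v y`. Of `v y` it sees, by a quantitative back-and-forth for Presburger
arithmetic (`IsPresburger.exists_snoc`), only the signs of finitely many affine forms and a
congruence modulo some `m!` (`realize_iff_of_isSimple`). So in a realization `(x, y)` of the
formula, `y` can be replaced by some `y₁` with the same angular component and with a value congruent
to `v y` modulo `m!`, but lying just above `(2m + 1) v(x)`. Since `1 ≤ v(x)`, this value is at most
a natural multiple of `v(x)`, against the gap type (`not_isIsolated_gapType`).

Rank one. This is an omitting-types construction inside an ultrapower. The conditions are the
nonempty definable sets of sequences in `K`; there are countably many, because the language is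
countable. If some condition prevented the entry `x c` from having value `∞` or an integer multiple
of `1`, then `t` with `v t = 1`, together with `x c` or its inverse, would isolate the gap type
(`exists_v_eq_ofInt`). Hence the conditions that fix such a value for an entry are dense, and so are
those that name an entry as a witness of an existential statement. A filter meeting all these dense
sets extends to an ultrafilter `U` on the set of sequences (`exists_isGeneric`). Modulo `U`, the
coordinate functions form a subfield of the ultrapower. The named witnesses give the theorem of Łoś
for this subfield (`realize_entryStructure`), so it is elementarily equivalent to `S`; its values
are integral, so its value group is `ℤ`. -/

namespace Pas

/-! ### Groups with a least positive element and division with remainder -/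

/-- `e` is the least positive element of `G`, and every element of `G` has a remainder modulo
`n` that is a multiple of `e`. -/
structure IsPresburger (G : Type*) [AddCommGroup G] [LinearOrder G] (e : G) : Prop where
  pos : 0 < e
  least : ∀ a : G, 0 < a → ¬ a < e
  div : ∀ n : ℕ, 1 < n → ∀ a : G, ∃ b : G, (∃ c : G, b = n • c) ∧ ¬ a < b ∧ a < b + n • e

/-! ### Presburger axioms as first-order sentences -/

section
open FirstOrder FirstOrder.Language

/-- The symbols of the Presburger language, as symbols of `presburgerLanguage`. -/
def symZero : presburgerLanguage.Constants := PrFunc.zero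
def symOne : presburgerLanguage.Constants := PrFunc.one
def symAdd : presburgerLanguage.Functions 2 := PrFunc.add
def symLt : presburgerLanguage.Relations 2 := PrRel.lt
def symDvd (n : ℕ) (hn : 1 < n) : presburgerLanguage.Relations 1 :=
  PrRel.dvd n hn

/-- The term `1 + ⋯ + 1`. -/
def presburgerNat {m : ℕ} : ℕ → presburgerLanguage.Term (Empty ⊕ Fin m)
  | 0 => Constants.term symZero
  | n + 1 => Functions.apply₂ symAdd (presburgerNat n) (Constants.term symOne)

/-- `0 < 1`. -/
def sentencePos : presburgerLanguage.Sentence :=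
  Relations.boundedFormula₂ (n := 0) symLt (presburgerNat 0) (Constants.term symOne)

/-- No positive element is less than `1`. -/
def sentenceLeast : presburgerLanguage.Sentence :=
  ∀' (Relations.boundedFormula₂ (n := 1) symLt (presburgerNat 0) &0 ⟹
    ∼(Relations.boundedFormula₂ (n := 1) symLt &0 (Constants.term symOne)))

/-- Division by `n` with remainder. -/
def sentenceDiv (n : ℕ) (hn : 1 < n) : presburgerLanguage.Sentence :=
  ∀' ∃' ((Relations.boundedFormula₁ (n := 2) (symDvd n hn) &1 ⊓
    ∼(Relations.boundedFormula₂ (n := 2) symLt &0 &1)) ⊓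
    Relations.boundedFormula₂ (n := 2) symLt &0
      (Functions.apply₂ symAdd &1 (presburgerNat n)))

variable {G : Type*} [AddCommGroup G] [LinearOrder G] {e : G}

lemma realize_presburgerNat {m : ℕ} (x : Empty ⊕ Fin m → G) (n : ℕ) :
    @Term.realize _ _ (presburgerGroupStructure G e) _ x (presburgerNat n) = n • e := by
  let := presburgerGroupStructure G e
  induction n with
  | zero =>
    simp only [presburgerNat, Term.realize_constants, zero_smul]
    rfl
  | succ n ih =>
    simp only [presburgerNat, Term.realize_functions_apply₂, ih, Term.realize_constants, succ_nsmul]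
    rfl

lemma realize_one {m : ℕ} (x : Empty ⊕ Fin m → G) :
    @Term.realize _ _ (presburgerGroupStructure G e) _ x (Constants.term symOne) = e := by
  let := presburgerGroupStructure G e
  simp only [Term.realize_constants]
  rfl

lemma realize_sentences :
    (@Sentence.Realize _ G (presburgerGroupStructure G e) sentencePos ∧
      @Sentence.Realize _ G (presburgerGroupStructure G e) sentenceLeast ∧
      ∀ n hn, @Sentence.Realize _ G (presburgerGroupStructure G e) (sentenceDiv n hn)) ↔
    IsPresburger G e := by
  let := presburgerGroupStructure G e
  have h1 : G ⊨ sentencePos ↔ 0 < e := by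
    simp only [sentencePos, Sentence.Realize, Language.Formula.Realize, BoundedFormula.realize_rel₂,
      realize_presburgerNat, realize_one, zero_smul]
    rfl
  have h2 : G ⊨ sentenceLeast ↔ ∀ a : G, 0 < a → ¬ a < e := by
    simp only [sentenceLeast, Sentence.Realize, Language.Formula.Realize, BoundedFormula.realize_rel₂,
      realize_presburgerNat, realize_one, zero_smul, BoundedFormula.realize_all,
      BoundedFormula.realize_imp, BoundedFormula.realize_not]
    rfl
  have h3 n hn : G ⊨ sentenceDiv n hn ↔
      ∀ a : G, ∃ b : G, ((∃ c : G, b = n • c) ∧ ¬ a < b) ∧ a < b + n • e := by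
    simp only [sentenceDiv, Sentence.Realize, Language.Formula.Realize, BoundedFormula.realize_rel₂,
      BoundedFormula.realize_rel₁, BoundedFormula.realize_inf, BoundedFormula.realize_ex,
      realize_presburgerNat, BoundedFormula.realize_all, Term.realize_functions_apply₂,
      BoundedFormula.realize_not]
    rfl
  refine ⟨fun ⟨a, b, c⟩ => ⟨h1.1 a, h2.1 b, fun n hn x => ?_⟩, fun h =>
    ⟨h1.2 h.pos, h2.2 h.least, fun n hn => (h3 n hn).2 fun x => ?_⟩⟩
  · obtain ⟨b, hb⟩ := (h3 n hn).1 (c n hn) x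
    exact ⟨b, hb.1.1, hb.1.2, hb.2⟩
  · obtain ⟨b, hb⟩ := h.div n hn x
    exact ⟨b, ⟨hb.1, hb.2.1⟩, hb.2.2⟩

lemma isPresburger_int : IsPresburger ℤ 1 where
  pos := one_pos
  least a h := by omega
  div n hn a := by
    refine ⟨n • (a / n), ⟨_, rfl⟩, ?_, ?_⟩ <;> simp only [nsmul_eq_mul, mul_one]
    · have := Int.mul_ediv_self_le (x := a) (k := n) (by omega); omega
    · have := Int.lt_mul_ediv_self_add (x := a) (k := n) (by omega); omega

/-- These properties are expressed by sentences true in `ℤ`. Nothing else about `ℤ`-groups is used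
later. -/
lemma IsZGroup.isPresburger (h : IsZGroup G e) : IsPresburger G e := by
  rw [← realize_sentences]
  have hZ := realize_sentences.2 isPresburger_int
  have h' := (@elementarilyEquivalent_iff _ _ _ (presburgerGroupStructure G e)
    (presburgerGroupStructure ℤ 1)).1 h
  exact ⟨(h' _).2 hZ.1, (h' _).2 hZ.2.1, fun n hn => (h' _).2 (hZ.2.2 n hn)⟩

end

section
variable {G : Type*} [AddCommGroup G] [LinearOrder G] [IsOrderedAddMonoid G] {e : G}

/-- The elements between `0` and `n • e` are multiples of `e`. -/
lemma IsPresburger.exists_eq_nsmul (h : IsPresburger G e) {n : ℕ} {a : G} (h0 : 0 ≤ a)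
    (hn : a < n • e) : ∃ r < n, a = r • e := by
  induction n with
  | zero => rw [zero_smul] at hn; exact absurd hn (not_lt.2 h0)
  | succ n ih =>
    rcases lt_or_ge a (n • e) with h1 | h1
    · obtain ⟨r, hr, hr'⟩ := ih h1
      exact ⟨r, hr.trans (Nat.lt_succ_self n), hr'⟩
    · refine ⟨n, Nat.lt_succ_self n, ?_⟩
      by_contra h2
      refine h.least (a - n • e) (sub_pos.2 (lt_of_le_of_ne h1 (Ne.symm h2))) ?_
      rw [sub_lt_iff_lt_add', ← succ_nsmul]
      exact hn

lemma IsPresburger.exists_div (h : IsPresburger G e) {n : ℕ} (hn : 0 < n) (a : G) :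
    ∃ r < n, ∃ b : G, a = n • b + r • e := by
  rcases Nat.lt_or_ge 1 n with h1 | h1
  · obtain ⟨b, ⟨c, rfl⟩, h2, h3⟩ := h.div n h1 a
    obtain ⟨r, hr, hr'⟩ := h.exists_eq_nsmul (sub_nonneg.2 (not_lt.1 h2)) (sub_lt_iff_lt_add'.2 h3)
    exact ⟨r, hr, c, by rw [← hr']; abel⟩
  · obtain rfl : n = 1 := by omega
    exact ⟨0, one_pos, a, by simp⟩

/-- A nonnegative element is congruent to a natural number in `[0, n]`, which is positive unless
the element is `0`. -/
lemma IsPresburger.exists_remainder (h : IsPresburger G e) {n : ℕ} (hn : 0 < n) {a : G}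
    (ha : 0 ≤ a) : ∃ r ≤ n, r • e ≤ a ∧ (r = 0 → a = 0) ∧ ∃ b : G, a = n • b + r • e := by
  rcases ha.eq_or_lt with rfl | ha
  · exact ⟨0, Nat.zero_le _, by simp, fun _ => rfl, 0, by simp⟩
  -- Dividing `a - e` instead of `a` moves the remainders from `[0, n)` to `[1, n]`, so that a
  -- positive element gets a positive remainder.
  · obtain ⟨r, hr, b, hb⟩ := h.exists_div hn (a - e)
    refine ⟨r + 1, hr, ?_, fun h => absurd h (Nat.succ_ne_zero r), b, by
      rw [succ_nsmul, ← add_assoc, ← hb, sub_add_cancel]⟩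
    -- A negative quotient is at most `-e`, and then `n • b + r • e < 0` because `r < n`.
    have hb0 : 0 ≤ b := by
      by_contra hb0
      have h1 : e ≤ -b := not_lt.1 (h.least _ (neg_pos.2 (not_le.1 hb0)))
      have h2 : n • e ≤ n • (-b) := nsmul_le_nsmul_right h1 n
      have h3 : 0 ≤ a - e := sub_nonneg.2 (not_lt.1 (h.least a ha))
      have h4 : r • e < n • e := nsmul_lt_nsmul_left h.pos hr
      rw [hb] at h3
      have h5 : n • b + n • (-b) = 0 := by simp
      have : n • b + r • e < n • b + n • (-b) := by
        gcongr
        exact h4.trans_le h2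
      exact absurd h3 (not_le.2 (by rwa [h5] at this))
    have : r • e ≤ a - e := by
      rw [hb]; exact le_add_of_nonneg_left (nsmul_nonneg hb0 n)
    rw [succ_nsmul]
    exact le_sub_iff_add_le.1 this

end

/-! ### Presburger back-and-forth -/

section
variable {G : Type*} [AddCommGroup G] {e : G}

/-- The affine form `∑ i, c i • a i + d • e`. -/
def affine (e : G) {n : ℕ} (c : Fin n → ℤ) (d : ℤ) (a : Fin n → G) : G :=
  ∑ i, c i • a i + d • e

lemma affine_zero {n : ℕ} (a : Fin n → G) : affine e 0 0 a = 0 := by simp [affine]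

lemma affine_smul {n : ℕ} (k : ℤ) (c : Fin n → ℤ) (d : ℤ) (a : Fin n → G) :
    affine e (k • c) (k * d) a = k • affine e c d a := by
  simp [affine, Finset.smul_sum, mul_smul, smul_add]

lemma affine_add {n : ℕ} (c c' : Fin n → ℤ) (d d' : ℤ) (a : Fin n → G) :
    affine e (c + c') (d + d') a = affine e c d a + affine e c' d' a := by
  simp only [affine, Pi.add_apply, add_smul, Finset.sum_add_distrib]; abel

lemma affine_sub {n : ℕ} (c c' : Fin n → ℤ) (d d' : ℤ) (a : Fin n → G) :
    affine e (c - c') (d - d') a = affine e c d a - affine e c' d' a := by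
  simp only [affine, Pi.sub_apply, sub_smul, Finset.sum_sub_distrib]; abel

lemma affine_snoc {n : ℕ} (c : Fin (n + 1) → ℤ) (d : ℤ) (a : Fin n → G) (b : G) :
    affine e c d (Fin.snoc a b : Fin (n + 1) → G) =
      c (Fin.last n) • b + affine e (fun i => c i.castSucc) d a := by
  simp only [affine, Fin.sum_univ_castSucc, Fin.snoc_castSucc, Fin.snoc_last]; abel

lemma affine_congr {n : ℕ} (N : ℕ) (c : Fin n → ℤ) (d : ℤ) {a a' : Fin n → G}
    (h : ∀ i, ∃ b : G, a i - a' i = N • b) : ∃ b, affine e c d a - affine e c d a' = N • b := by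
  choose b hb using h
  refine ⟨∑ i, c i • b i, ?_⟩
  simp only [affine, add_sub_add_right_eq_sub, ← Finset.sum_sub_distrib, ← smul_sub, hb,
    Finset.smul_sum]
  exact Finset.sum_congr rfl fun i _ => smul_comm _ _ _

/-! ### Similarity of tuples -/

variable [LinearOrder G]

/-- Two tuples are `m`-similar if the affine forms with coefficients bounded by `m` have the same
sign on both, and if they are congruent modulo `m !`. -/
structure Sim (e : G) (m : ℕ) {n : ℕ} (a a' : Fin n → G) : Prop where
  pos_iff : ∀ (c : Fin n → ℤ) (d : ℤ), (∀ i, |c i| ≤ m) → |d| ≤ m →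
    (0 < affine e c d a ↔ 0 < affine e c d a')
  congr : ∀ i, ∃ b : G, a i - a' i = m.factorial • b

lemma Sim.mono {m M : ℕ} (h : m ≤ M) {n : ℕ} {a a' : Fin n → G} (H : Sim e M a a') :
    Sim e m a a' where
  pos_iff c d hc hd := H.pos_iff c d (fun i => (hc i).trans (by exact_mod_cast h))
    (hd.trans (by exact_mod_cast h))
  congr i := by
    obtain ⟨b, hb⟩ := H.congr i
    obtain ⟨k, hk⟩ := Nat.factorial_dvd_factorial h
    exact ⟨k • b, by rw [hb, hk, mul_smul]⟩

lemma Sim.symm {m n : ℕ} {a a' : Fin n → G} (H : Sim e m a a') : Sim e m a' a where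
  pos_iff c d hc hd := (H.pos_iff c d hc hd).symm
  congr i := by
    obtain ⟨b, hb⟩ := H.congr i
    exact ⟨-b, by rw [smul_neg, ← hb, neg_sub]⟩

variable [IsOrderedAddMonoid G]

/-- The difference of the two forms has coefficients bounded by `B + B'`, so its sign is preserved.
-/
lemma Sim.lt_iff {m B B' : ℕ} {n : ℕ} {a a' : Fin n → G} (H : Sim e m a a')
    (hB : B + B' ≤ m) {c c' : Fin n → ℤ} {d d' : ℤ} (hc : ∀ i, |c i| ≤ B) (hd : |d| ≤ B)
    (hc' : ∀ i, |c' i| ≤ B') (hd' : |d'| ≤ B') :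
    affine e c d a < affine e c' d' a ↔ affine e c d a' < affine e c' d' a' := by
  have hB' : (B : ℤ) + B' ≤ m := by exact_mod_cast hB
  rw [← sub_pos, ← affine_sub, ← sub_pos (a := affine e c' d' a'), ← affine_sub]
  refine H.pos_iff _ _ (fun i => ?_) ?_
  · have := abs_sub (c' i) (c i); have := hc i; have := hc' i
    simp only [Pi.sub_apply]; lia
  · have := abs_sub d' d; lia

/-- It is enough that the position of `k • b` among affine forms is the same, and congruences. -/
lemma Sim.snoc {m L : ℕ} {n : ℕ} {a a' : Fin n → G} {b b' : G} (H : Sim e m a a')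
    (hL : L = m.factorial) (hb : ∃ x : G, b - b' = L • x)
    (hpos : ∀ (c : Fin n → ℤ) (d : ℤ), (∀ i, |c i| ≤ m * L) → |d| ≤ m * L →
      (affine e c d a < L • b ↔ affine e c d a' < L • b') ∧
      (L • b < affine e c d a ↔ L • b' < affine e c d a')) :
    Sim e m (Fin.snoc a b : Fin (n + 1) → G) (Fin.snoc a' b') where
  pos_iff c d hc hd := by
    rw [affine_snoc, affine_snoc]
    set c₀ : Fin n → ℤ := fun i => c i.castSucc
    set k := c (Fin.last n) with hk
    have hkm : |k| ≤ m := hc _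
    rcases eq_or_ne k 0 with h0 | h0
    · rw [h0, zero_smul, zero_smul, zero_add, zero_add]
      exact H.pos_iff _ _ (fun i => hc _) hd
    -- Every nonzero `k` with `|k| ≤ m` divides `L = m!`. Multiplying the form by `q = L / k`
    -- normalizes the coefficient of `b` to `L` and enlarges the others by a factor of at most `L`,
    -- whence the bound `m * L`.
    · obtain ⟨q, hq⟩ : k ∣ (L : ℤ) := by
        rw [← Int.natAbs_dvd_natAbs, Int.natAbs_natCast, hL]
        exact Nat.dvd_factorial (Int.natAbs_pos.2 h0) (by rw [Int.abs_eq_natAbs] at hkm; lia)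
      have hL0 : 0 < (L : ℤ) := by rw [hL]; exact_mod_cast m.factorial_pos
      have hqL : |q| ≤ L := by
        have : |k| * |q| = L := by rw [← abs_mul, ← hq, abs_of_pos hL0]
        have h1 : 1 ≤ |k| := Int.one_le_abs h0
        nlinarith [abs_nonneg q]
      have hbound : ∀ z : ℤ, |z| ≤ m → ∀ s : ℤ, |s| = |q| → |s * z| ≤ m * L := fun z hz s hs => by
        rw [abs_mul, hs, mul_comm]
        exact mul_le_mul hz hqL (abs_nonneg _) (by positivity)
      have key : ∀ (b : G) (a : Fin n → G), q • (k • b + affine e c₀ d a) =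
          L • b - affine e (-q • c₀) (-q * d) a := fun b a => by
        rw [affine_smul, smul_add, smul_smul, mul_comm, ← hq, natCast_zsmul, neg_smul,
          sub_neg_eq_add]
      obtain ⟨h1, h2⟩ := hpos (-q • c₀) (-q * d)
        (fun i => hbound _ (hc _) _ (abs_neg q)) (hbound _ hd _ (abs_neg q))
      rw [← sub_pos, ← key, ← sub_pos (a := L • b'), ← key] at h1
      rw [← sub_neg, ← key, ← sub_neg (a := L • b'), ← key] at h2
      have hq0 : q ≠ 0 := by rintro rfl; simp at hq; lia
      -- The sign of `q` decides which of the two comparisons with `L • b` is needed.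
      rcases lt_or_gt_of_ne hq0 with hq0 | hq0
      · have sm : ∀ y : G, 0 < y ↔ q • y < 0 := fun y => by
          rw [← neg_pos, ← neg_smul, smul_pos_iff_of_pos_left (by lia : 0 < -q)]
        rw [sm, sm (k • b' + _)]; exact h2
      · have sm : ∀ y : G, 0 < y ↔ 0 < q • y := fun y => by
          rw [smul_pos_iff_of_pos_left hq0]
        rw [sm, sm (k • b' + _)]; exact h1
  congr i := by
    induction i using Fin.lastCases with
    | last => simpa [← hL] using hb
    | cast i => simpa using H.congr i

lemma Sim.snoc_neg {m n : ℕ} {a a' : Fin n → G} {b b' : G}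
    (H : Sim e m (Fin.snoc a b : Fin (n + 1) → G) (Fin.snoc a' b')) :
    Sim e m (Fin.snoc a (-b) : Fin (n + 1) → G) (Fin.snoc a' (-b')) where
  pos_iff c d hc hd := by
    have := H.pos_iff (Fin.snoc (fun i => c i.castSucc) (-c (Fin.last n)) : Fin (n + 1) → ℤ) d
      (fun i => by
        induction i using Fin.lastCases with
        | last => simpa using hc _
        | cast i => simpa using hc _) hd
    simpa [affine_snoc] using this
  congr i := by
    induction i using Fin.lastCases with
    | last =>
      obtain ⟨x, hx⟩ := H.congr (Fin.last n)
      refine ⟨-x, ?_⟩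
      simp only [Fin.snoc_last] at hx ⊢
      rw [smul_neg, ← hx]; abel
    | cast i => simpa using H.congr i.castSucc

open Finset in
-- Let `s` be the greatest affine form in `a`, with coefficients bounded by `m * L`, that does not
-- exceed `L • b`, and let `s'` be the same form in `a'`. Replace the distance `L • b - s` by a
-- remainder `r • e` modulo `L * L`, and choose `b'` with `L • b' = s' + r • e`. No bounded form
-- lies strictly between `s` and `L • b`, so the position of `L • b'` among the forms in `a'` is the
-- same.
lemma IsPresburger.exists_snoc_of_nonneg (he : IsPresburger G e) (m n : ℕ) {a a' : Fin n → G}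
    {L : ℕ} (hL : L = m.factorial) (H : Sim e (m * L + L * L + m * L) a a') {b : G} (hb : 0 ≤ b) :
    ∃ b', Sim e m (Fin.snoc a b : Fin (n + 1) → G) (Fin.snoc a' b') := by
  have hL0 : 0 < L := by rw [hL]; exact m.factorial_pos
  have hmL : m ≤ m * L := Nat.le_mul_of_pos_right m hL0
  let T : Finset ((Fin n → ℤ) × ℤ) :=
    (Fintype.piFinset fun _ => Icc (-(m * L : ℤ)) (m * L)) ×ˢ Icc (-(m * L : ℤ)) (m * L)
  have hT : ∀ t : (Fin n → ℤ) × ℤ, t ∈ T ↔ (∀ i, |t.1 i| ≤ m * L) ∧ |t.2| ≤ m * L := fun t => by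
    simp [T, Fintype.mem_piFinset, abs_le]
  obtain ⟨t₀, ht₀, hmax⟩ := exists_max_image (T.filter fun t => affine e t.1 t.2 a ≤ L • b)
    -- The zero form is a candidate; this is where `0 ≤ b` is used.
    (fun t => affine e t.1 t.2 a) ⟨0, by
      simp only [mem_filter, hT]
      refine ⟨⟨fun i => by simp; positivity, by simp; positivity⟩, ?_⟩
      simpa [affine_zero] using nsmul_nonneg hb L⟩
  simp only [mem_filter, hT] at ht₀ hmax
  obtain ⟨⟨hc₀, hd₀⟩, hle⟩ := ht₀
  -- The modulus is `L * L` because one factor `L` is lost when passing from `L • b` to `b`, and a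
  -- congruence modulo `L` must remain.
  obtain ⟨r, hr, hrs, hr0, w, hw⟩ := he.exists_remainder (Nat.mul_pos hL0 hL0) (sub_nonneg.2 hle)
  obtain ⟨x, hx⟩ := affine_congr (e := e) (L * L) t₀.1 t₀.2 (a := a) (a' := a') fun i => by
    obtain ⟨b, hb⟩ := H.congr i
    obtain ⟨k, hk⟩ := Nat.dvd_factorial (Nat.mul_pos hL0 hL0)
      (show L * L ≤ m * L + L * L + m * L by lia)
    exact ⟨k • b, by rw [hb, hk, mul_smul]⟩
  set s := affine e t₀.1 t₀.2 a with hs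
  set s' := affine e t₀.1 t₀.2 a' with hs'
  have hb' : L • (b - L • (w + x)) = s' + r • e := by
    have h1 : L • b = s + ((L * L) • w + r • e) := by rw [← hw]; abel
    have h2 : s = s' + (L * L) • x := by rw [← hx]; abel
    rw [smul_sub, h1, h2, smul_smul, smul_add]; abel
  refine ⟨b - L • (w + x), Sim.snoc (H.mono (by lia)) hL ⟨w + x, by abel⟩ fun c d hc hd => ?_⟩
  rw [hb']
  set t := affine e c d a with ht
  set t' := affine e c d a' with ht'
  have hmLcast : ((m * L : ℕ) : ℤ) = m * L := by push_cast; rfl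
  have cmp1 : s < t ↔ s' < t' := H.lt_iff (B := m * L) (B' := m * L) (by lia)
    (by simpa using hc₀) (by simpa using hd₀) (by simpa using hc) (by simpa using hd)
  have cmp1' : t < s ↔ t' < s' := H.lt_iff (B := m * L) (B' := m * L) (by lia)
    (by simpa using hc) (by simpa using hd) (by simpa using hc₀) (by simpa using hd₀)
  have shift : ∀ a : Fin n → G, affine e t₀.1 (t₀.2 + r) a = affine e t₀.1 t₀.2 a + r • e :=
    fun a => by simp only [affine, add_smul, natCast_zsmul, add_assoc]
  -- Adding `r` to the constant term costs at most `L * L`; this accounts for the middle summand of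
  -- the similarity assumed in `H`.
  have cmp2 : s + r • e < t ↔ s' + r • e < t' := by
    have := H.lt_iff (B := m * L + L * L) (B' := m * L) (c := t₀.1) (d := t₀.2 + r)
      (c' := c) (d' := d) le_rfl (fun i => (hc₀ i).trans (by push_cast; nlinarith))
      ((abs_add_le _ _).trans (by
        have : (r : ℤ) ≤ L * L := by exact_mod_cast hr
        push_cast; rw [Nat.abs_cast]; lia)) (by simpa using hc) (by simpa using hd)
    rwa [shift, shift] at this
  have hre : 0 ≤ r • e := nsmul_nonneg he.pos.le r
  have hr1 : r • e = 0 → r = 0 := fun h => by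
    by_contra h0
    exact (nsmul_pos he.pos h0).ne' h
  rcases le_or_gt t (L • b) with h | h
  · have h1 : t ≤ s := hmax (c, d) ⟨⟨hc, hd⟩, h⟩
    have h1' : t' ≤ s' := not_lt.1 fun h' => absurd (cmp1.2 h') (not_lt.2 h1)
    have h2 : t' ≤ s' + r • e := h1'.trans (le_add_of_nonneg_right hre)
    refine ⟨?_, iff_of_false (not_lt.2 h) (not_lt.2 h2)⟩
    -- Only the case of equality is left. It matches on both sides because `r = 0` exactly when `L •
    -- b = s`.
    rw [lt_iff_le_and_ne, lt_iff_le_and_ne]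
    refine and_congr (iff_of_true h h2) (not_congr ?_)
    constructor
    · intro h3
      have h4 : t = s := le_antisymm h1 (h3 ▸ hle)
      have h5 : t' = s' := le_antisymm h1' (not_lt.1 fun h' => (cmp1'.2 h').ne h4)
      have h6 : s' + r • e ≤ s' := by
        rw [← h3, h4, sub_self] at hrs
        exact add_le_of_nonpos_right hrs
      exact le_antisymm h2 (h5 ▸ h6)
    · intro h3
      have h4 : r • e = 0 := by
        refine le_antisymm ?_ hre
        have : s' + r • e ≤ s' := h3 ▸ h1'
        exact nonpos_of_add_le_right this
      have h5 : t' = s' := by rw [h3, h4, add_zero]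
      have h6 : t = s := le_antisymm h1 (not_lt.1 fun h' => (cmp1'.1 h').ne h5)
      rw [h6]
      exact (sub_eq_zero.1 (hr0 (hr1 h4))).symm
  · refine ⟨iff_of_false h.not_gt (not_lt.2 (cmp2.1 ?_).le), iff_of_true h (cmp2.1 ?_)⟩ <;>
    exact (le_sub_iff_add_le'.1 hrs).trans_lt h

lemma IsPresburger.exists_snoc (he : IsPresburger G e) (m : ℕ) :
    ∃ M, ∀ {n : ℕ} {a a' : Fin n → G}, Sim e M a a' → ∀ b : G,
      ∃ b', Sim e m (Fin.snoc a b : Fin (n + 1) → G) (Fin.snoc a' b') := by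
  refine ⟨m * m.factorial + m.factorial * m.factorial + m * m.factorial, fun {n a a'} H b => ?_⟩
  rcases le_total 0 b with h | h
  · exact he.exists_snoc_of_nonneg m _ rfl H h
  · obtain ⟨b', hb'⟩ := he.exists_snoc_of_nonneg m _ rfl H (neg_nonneg.2 h)
    exact ⟨-b', by simpa using hb'.snoc_neg⟩

lemma Sim.eq_iff {m B B' : ℕ} {n : ℕ} {a a' : Fin n → G} (H : Sim e m a a')
    (hB : B + B' ≤ m) {c c' : Fin n → ℤ} {d d' : ℤ} (hc : ∀ i, |c i| ≤ B) (hd : |d| ≤ B)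
    (hc' : ∀ i, |c' i| ≤ B') (hd' : |d'| ≤ B') :
    affine e c d a = affine e c' d' a ↔ affine e c d a' = affine e c' d' a' := by
  rw [← not_iff_not, ← Ne, ← Ne, ne_iff_lt_or_gt, ne_iff_lt_or_gt, H.lt_iff hB hc hd hc' hd',
    H.lt_iff (by lia) hc' hd' hc hd]

end

/-! ### Angular components -/

lemma isUnit_valuationRing_iff {K : Type u} {Γ : Type w} [Field K] [AddCommGroup Γ]
    [LinearOrder Γ] [IsOrderedAddMonoid Γ] (v : AddValuation K (WithTop Γ)) {a : valuationRing v} :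
    IsUnit a ↔ v a = 0 := by
  constructor
  · rintro ⟨u, rfl⟩
    have h : v ((u : valuationRing v) : K) + v ((u⁻¹ : (valuationRing v)ˣ) :
        valuationRing v) = 0 := by
      rw [← v.map_mul, ← v.map_one]
      congr 1
      exact_mod_cast congrArg Subtype.val u.mul_inv
    refine le_antisymm ?_ (u : valuationRing v).2
    rw [← h]
    exact le_add_of_nonneg_right ((u⁻¹ : (valuationRing v)ˣ) : valuationRing v).2
  · intro h
    have ha : (a : K) ≠ 0 := fun h0 => by
      rw [h0, v.map_zero] at h; exact WithTop.top_ne_zero h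
    have h1 : v (a : K)⁻¹ = 0 := by
      have : v (a : K) + v (a : K)⁻¹ = 0 := by
        rw [← v.map_mul, mul_inv_cancel₀ ha, v.map_one]
      rwa [h, zero_add] at this
    exact isUnit_iff_exists_inv.2 ⟨⟨(a : K)⁻¹, h1.ge⟩, Subtype.ext (mul_inv_cancel₀ ha)⟩

namespace PasStructure
variable (S : PasStructure.{u, w})

lemma v_eq_top_iff {x : S.K} : S.v x = ⊤ ↔ x = 0 := AddValuation.top_iff S.v

lemma ac_zero : S.ac 0 = 0 := S.isAngularComponent.map_zero

lemma ac_ne_zero {x : S.K} (hx : x ≠ 0) : S.ac x ≠ 0 := by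
  obtain ⟨f, hf⟩ := S.isAngularComponent.map_units
  have := hf (Units.mk0 x hx)
  rw [Units.val_mk0] at this
  rw [this]
  exact Units.ne_zero _

lemma ac_mul (x y : S.K) : S.ac (x * y) = S.ac x * S.ac y := by
  rcases eq_or_ne x 0 with rfl | hx
  · simp [ac_zero]
  rcases eq_or_ne y 0 with rfl | hy
  · simp [ac_zero]
  obtain ⟨f, hf⟩ := S.isAngularComponent.map_units
  have := hf (Units.mk0 x hx * Units.mk0 y hy)
  rw [map_mul, Units.val_mul, Units.val_mul, ← hf, ← hf] at this
  exact this

lemma isUnit_iff {a : valuationRing S.v} : IsUnit a ↔ S.v a = 0 := isUnit_valuationRing_iff S.v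

lemma ac_eq_residue (a : valuationRing S.v) (h : S.v a = 0) :
    S.ac a = IsLocalRing.residue _ a :=
  S.isAngularComponent.map_residue a (S.isUnit_iff.2 h)

lemma ac_one : S.ac 1 = 1 := by
  simpa using S.ac_eq_residue 1 (by simp)

lemma ac_pow (x : S.K) (n : ℕ) : S.ac (x ^ n) = S.ac x ^ n := by
  induction n with
  | zero => simp [ac_one]
  | succ n ih => rw [pow_succ, pow_succ, ac_mul, ih]

lemma residue_eq_zero_iff {a : valuationRing S.v} :
    IsLocalRing.residue (valuationRing S.v) a = 0 ↔ 0 < S.v a := by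
  rw [← not_iff_not, ← Ne, IsLocalRing.residue_ne_zero_iff_isUnit, isUnit_iff, not_lt]
  exact ⟨fun h => h.le, fun h => le_antisymm h a.2⟩

/-- The value and the angular component of `a + x` for an element `a` of value `0` and an
infinitesimal element `x`. -/
lemma v_ac_add {a : valuationRing S.v} {x : S.K} (ha : S.v a = 0) (hx : 0 < S.v x) :
    S.v (a + x) = 0 ∧ S.ac (a + x) = IsLocalRing.residue _ a := by
  have h1 : S.v (a + x) = 0 := by rw [S.v.map_add_eq_of_lt_left (by rwa [ha]), ha]
  refine ⟨h1, ?_⟩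
  have h2 := S.ac_eq_residue (a + ⟨x, hx.le⟩) h1
  rw [map_add, (S.residue_eq_zero_iff (a := ⟨x, hx.le⟩)).2 hx, add_zero] at h2
  exact h2

/-- Write `x + y = x (1 + y / x)`; the second factor has residue `1`. -/
lemma ac_add_of_lt {x y : S.K} (h : S.v x < S.v y) : S.ac (x + y) = S.ac x := by
  have hx : x ≠ 0 := by
    rintro rfl
    rw [S.v.map_zero] at h
    exact not_top_lt h
  have h2 : 0 < S.v (x⁻¹ * y) := by
    by_contra! h'
    have : S.v x + S.v (x⁻¹ * y) = S.v y := by rw [← S.v.map_mul, mul_inv_cancel_left₀ hx]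
    rw [← this] at h
    exact absurd h (not_lt.2 (add_le_of_nonpos_right h'))
  have h3 := (S.v_ac_add (a := 1) (by simp) h2).2
  have : x + y = x * (1 + x⁻¹ * y) := by rw [mul_add, mul_one, mul_inv_cancel_left₀ hx]
  rw [this, ac_mul]
  simp only [OneMemClass.coe_one, map_one] at h3
  rw [h3, mul_one]

/-- Any element of value `m` can be corrected by a unit with the appropriate residue. -/
lemma exists_v_ac (m : S.Γ) {b : S.k} (hb : b ≠ 0) : ∃ x : S.K, S.v x = m ∧ S.ac x = b := by
  obtain ⟨x, hx⟩ := S.v_surjective m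
  have hx0 : x ≠ 0 := fun h => by
    rw [h, S.v.map_zero] at hx; exact WithTop.top_ne_coe hx
  obtain ⟨u, hu⟩ := IsLocalRing.residue_surjective (R := valuationRing S.v) (b / S.ac x)
  have hu0 : S.v u = 0 := by
    rw [← isUnit_iff, ← IsLocalRing.residue_ne_zero_iff_isUnit, hu]
    exact div_ne_zero hb (S.ac_ne_zero hx0)
  refine ⟨x * u, by rw [S.v.map_mul, hx, hu0, add_zero], ?_⟩
  rw [ac_mul, S.ac_eq_residue u hu0, hu, mul_div_cancel₀ _ (S.ac_ne_zero hx0)]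

lemma ac_surjective : Function.Surjective S.ac := fun b => by
  rcases eq_or_ne b 0 with rfl | hb
  · exact ⟨0, S.ac_zero⟩
  · obtain ⟨x, -, hx⟩ := S.exists_v_ac 0 hb
    exact ⟨x, hx⟩

lemma v_surjective' : Function.Surjective S.v := fun b => by
  induction b with
  | top => exact ⟨0, S.v.map_zero⟩
  | coe b => exact S.v_surjective b

/-! ### Values of polynomials -/

open Polynomial

/-- Evaluation of bivariate polynomials in the valuation ring. -/
noncomputable def evalRing (x y : valuationRing S.v) : ℤ[X][X] →+* valuationRing S.v :=
  eval₂RingHom (eval₂RingHom (Int.castRingHom _) x) y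

/-- Evaluation of bivariate polynomials. -/
noncomputable def evalField (x y : S.K) : ℤ[X][X] →+* S.K :=
  eval₂RingHom (eval₂RingHom (Int.castRingHom _) x) y

lemma evalRing_coe (x y : valuationRing S.v) (p : ℤ[X][X]) :
    (S.evalRing x y p : S.K) = S.evalField x y p := by
  have : (valuationRing S.v).subtype.comp (S.evalRing x y) = S.evalField x y := by
    refine Polynomial.ringHom_ext' (Polynomial.ringHom_ext' (Subsingleton.elim _ _) ?_) ?_ <;>
    simp [evalRing, evalField]
  exact congrArg (· p) this

lemma evalField_C (x y : S.K) (p : ℤ[X]) :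
    S.evalField x y (C p) = eval₂ (Int.castRingHom _) x p := by
  simp only [evalField, coe_eval₂RingHom, eval₂_C]

lemma v_evalField_nonneg {x y : S.K} (hx : 0 ≤ S.v x) (hy : 0 ≤ S.v y) (p : ℤ[X][X]) :
    0 ≤ S.v (S.evalField x y p) := by
  rw [← S.evalRing_coe ⟨x, hx⟩ ⟨y, hy⟩]
  exact (S.evalRing _ _ p).2

/-- This is the point where residue characteristic zero enters: integer coefficients do not change
values. -/
lemma v_ac_intCast (hk : CharZero S.k) {c : ℤ} (hc : c ≠ 0) :
    S.v (c : S.K) = 0 ∧ S.ac (c : S.K) = c := by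
  have h1 : IsLocalRing.residue (valuationRing S.v) c = (c : S.k) := map_intCast _ c
  have h2 : S.v ((c : valuationRing S.v) : S.K) = 0 := by
    rw [← isUnit_iff, ← IsLocalRing.residue_ne_zero_iff_isUnit, h1]
    exact_mod_cast hc
  have h3 := S.ac_eq_residue _ h2
  rw [h1] at h3
  have : ((c : valuationRing S.v) : S.K) = c := by push_cast; rfl
  rw [this] at h2 h3
  exact ⟨h2, h3⟩

lemma exists_eq_X_pow_mul {R : Type*} [CommRing R] (p : R[X]) (hp : p ≠ 0) :
    ∃ (r : ℕ) (c : R) (q : R[X]), c ≠ 0 ∧ p = X ^ r * (C c + X * q) := by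
  obtain ⟨q, h1, h2⟩ := exists_eq_pow_rootMultiplicity_mul_and_not_dvd p hp 0
  rw [map_zero, sub_zero] at h1 h2
  refine ⟨rootMultiplicity 0 p, q.coeff 0, q.divX, fun h => h2 (X_dvd_iff.2 h), ?_⟩
  rw [mul_comm X q.divX, add_comm, divX_mul_X_add]
  exact h1

lemma v_ac_evalField_C (hk : CharZero S.k) (p : ℤ[X]) (hp : p ≠ 0) :
    ∃ (r : ℕ) (c : ℤ), c ≠ 0 ∧ ∀ x y : S.K, 0 < S.v x →
      S.v (S.evalField x y (C p)) = r • S.v x ∧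
      S.ac (S.evalField x y (C p)) = c * S.ac x ^ r := by
  obtain ⟨r, c, q, hc, rfl⟩ := exists_eq_X_pow_mul p hp
  refine ⟨r, c, hc, fun x y hx => ?_⟩
  have h1 : S.evalField x y (C (X ^ r * (C c + X * q))) =
      x ^ r * (c + x * S.evalField x y (C q)) := by
    simp only [evalField_C, eval₂_mul, eval₂_add, eval₂_pow, eval₂_X, eval₂_C, Int.coe_castRingHom]
  have h2 : S.evalField x y (C q) = S.evalField x 0 (C q) := by
    simp only [evalField_C]
  have h3 : 0 < S.v (x * S.evalField x y (C q)) := by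
    rw [S.v.map_mul, h2]
    exact add_pos_of_pos_of_nonneg hx (S.v_evalField_nonneg hx.le (by simp) _)
  obtain ⟨h4, h5⟩ := S.v_ac_intCast hk hc
  rw [h1, S.v.map_mul, ac_mul, S.v.map_pow, ac_pow, S.v.map_add_eq_of_lt_left (by rwa [h4]),
    S.ac_add_of_lt (by rwa [h4]), h4, h5, add_zero, mul_comm]
  exact ⟨rfl, rfl⟩

/-- Write `p = Y ^ m (g(X) + Y q)` with `g ≠ 0`. The value of `g(x)` is `r • v(x)`, where `X ^ r` is
the power of `X` dividing `g` exactly; since `r • v(x) < v(y)`, the term `Y q` is negligible. -/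
lemma v_ac_evalField (hk : CharZero S.k) (p : ℤ[X][X]) (hp : p ≠ 0) :
    ∃ (r m : ℕ) (c : ℤ), c ≠ 0 ∧ ∀ x y : S.K, 0 < S.v x → r • S.v x < S.v y →
      S.v (S.evalField x y p) = r • S.v x + m • S.v y ∧
      S.ac (S.evalField x y p) = c * S.ac x ^ r * S.ac y ^ m := by
  obtain ⟨m, g, q, hg, rfl⟩ := exists_eq_X_pow_mul p hp
  obtain ⟨r, c, hc, H⟩ := S.v_ac_evalField_C hk g hg
  refine ⟨r, m, c, hc, fun x y hx hxy => ?_⟩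
  obtain ⟨h1, h2⟩ := H x y hx
  have hy : 0 ≤ S.v y := (nsmul_nonneg hx.le r).trans hxy.le
  have h3 : S.v (S.evalField x y (C g)) < S.v (y * S.evalField x y q) := by
    rw [h1, S.v.map_mul]
    exact hxy.trans_le (le_add_of_nonneg_right (S.v_evalField_nonneg hx.le hy _))
  have h4 : S.evalField x y (X ^ m * (C g + X * q)) =
      y ^ m * (S.evalField x y (C g) + y * S.evalField x y q) := by
    simp [evalField]
  rw [h4, S.v.map_mul, ac_mul, S.v.map_pow, ac_pow, S.v.map_add_eq_of_lt_left h3,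
    S.ac_add_of_lt h3, h1, h2, add_comm, mul_comm]
  exact ⟨rfl, rfl⟩

lemma exists_evalField_eq (t : KTerm 2) :
    ∃ p : ℤ[X][X], ∀ x : Fin 2 → S.K, t.eval S x = S.evalField (x 0) (x 1) p := by
  induction t with
  | var a =>
    fin_cases a
    · exact ⟨C X, fun x => by simp [KTerm.eval, evalField]⟩
    · exact ⟨X, fun x => by simp [KTerm.eval, evalField]⟩
  | zero => exact ⟨0, fun x => by simp [KTerm.eval]⟩
  | one => exact ⟨1, fun x => by simp [KTerm.eval]⟩
  | add s t hs ht =>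
    obtain ⟨p, hp⟩ := hs
    obtain ⟨q, hq⟩ := ht
    exact ⟨p + q, fun x => by simp [KTerm.eval, hp, hq]⟩
  | mul s t hs ht =>
    obtain ⟨p, hp⟩ := hs
    obtain ⟨q, hq⟩ := ht
    exact ⟨p * q, fun x => by simp [KTerm.eval, hp, hq]⟩
  | neg s hs =>
    obtain ⟨p, hp⟩ := hs
    exact ⟨-p, fun x => by simp [KTerm.eval, hp]⟩

/-- A term in two variables of the field sort vanishes identically, or its value and its angular
component are given by a monomial wherever the second variable is infinitesimal enough relative
to the first one. -/
lemma eval_eq_zero_or (hk : CharZero S.k) (t : KTerm 2) :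
    (∀ x : Fin 2 → S.K, t.eval S x = 0) ∨
    ∃ (r m : ℕ) (c : S.k), ∀ x : Fin 2 → S.K, 0 < S.v (x 0) → r • S.v (x 0) < S.v (x 1) →
      S.v (t.eval S x) = r • S.v (x 0) + m • S.v (x 1) ∧
      S.ac (t.eval S x) = c * S.ac (x 0) ^ r * S.ac (x 1) ^ m := by
  obtain ⟨p, hp⟩ := S.exists_evalField_eq t
  rcases eq_or_ne p 0 with rfl | h
  · exact Or.inl fun x => by rw [hp, map_zero]
  · obtain ⟨r, m, c, -, H⟩ := S.v_ac_evalField hk p h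
    exact Or.inr ⟨r, m, c, fun x h0 h1 => by rw [hp]; exact H _ _ h0 h1⟩

end PasStructure

/-! ### Tuples with entries in `Γ ∪ {∞}` -/

section
variable {G : Type*} [AddCommGroup G] {e : G}

lemma affine_single {n : ℕ} (i : Fin n) (a : Fin n → G) :
    affine e (Pi.single i 1) 0 a = a i := by
  simp [affine, Pi.single_apply, ite_smul]

/-- This serves the variables with value `∞`, which are encoded by `0`. -/
lemma Sim.snoc_zero [LinearOrder G] {m n : ℕ} {a a' : Fin n → G} (H : Sim e m a a') :
    Sim e m (Fin.snoc a 0 : Fin (n + 1) → G) (Fin.snoc a' 0) where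
  pos_iff c d hc hd := by
    simpa [affine_snoc] using H.pos_iff (fun i => c i.castSucc) d (fun i => hc _) hd
  congr i := by
    induction i using Fin.lastCases with
    | last => exact ⟨0, by simp⟩
    | cast i => simpa using H.congr i

lemma eq_coe_untopD {a : WithTop G} (ha : a ≠ ⊤) : a = (a.untopD 0 : G) := by
  obtain ⟨b, rfl⟩ := WithTop.ne_top_iff_exists.1 ha
  rfl

lemma nsmul_top_eq {n : ℕ} (hn : 1 < n) : n • (⊤ : WithTop G) = ⊤ := by
  obtain ⟨k, rfl⟩ := Nat.exists_eq_succ_of_ne_zero (by lia : n ≠ 0)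
  rw [succ_nsmul, WithTop.add_top]

lemma coe_dvd_iff {n : ℕ} (hn : 1 < n) (a : G) :
    (∃ m : WithTop G, (a : WithTop G) = n • m) ↔ ∃ b : G, a = n • b := by
  constructor
  · rintro ⟨m, hm⟩
    induction m with
    | top => rw [nsmul_top_eq hn] at hm; exact absurd hm WithTop.coe_ne_top
    | coe b => exact ⟨b, by exact_mod_cast hm⟩
  · rintro ⟨b, rfl⟩
    exact ⟨b, by norm_cast⟩

end

namespace PasStructure
variable (S : PasStructure.{u, w})

/-! ### Simple formulas do not separate points with similar values -/

/-- `x' 1` differs from `x 1` only in its value, both are nonzero, and their values are larger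
than `m` times the positive value of `x 0 = x' 0`. -/
structure Close (m : ℕ) (x x' : Fin 2 → S.K) : Prop where
  zero_eq : x' 0 = x 0
  pos : 0 < S.v (x 0)
  ne_top : S.v (x 0) ≠ ⊤
  lt : m • S.v (x 0) < S.v (x 1)
  lt' : m • S.v (x 0) < S.v (x' 1)
  one_ne_top : S.v (x 1) ≠ ⊤
  one_ne_top' : S.v (x' 1) ≠ ⊤
  ac_eq : S.ac (x' 1) = S.ac (x 1)

/-- The values of `x 0` and `x 1`, followed by `z`, with `∞` replaced by `0`. -/
def values {l : ℕ} (x : Fin 2 → S.K) (z : Fin l → S.Γinf) : Fin (l + 1 + 1) → S.Γ :=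
  Fin.cons ((S.v (x 0)).untopD 0) (Fin.cons ((S.v (x 1)).untopD 0)
    (fun i => (z i).untopD 0) : Fin (l + 1) → S.Γ)

lemma values_snoc {l : ℕ} (x : Fin 2 → S.K) (z : Fin l → S.Γinf) (c : S.Γinf) :
    S.values x (Fin.snoc z c : Fin (l + 1) → S.Γinf) =
      Fin.snoc (S.values x z) (c.untopD 0) := by
  have : (fun i => ((Fin.snoc z c : Fin (l + 1) → S.Γinf) i).untopD 0) =
      (Fin.snoc (fun i => (z i).untopD 0) (c.untopD 0) : Fin (l + 1) → S.Γ) :=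
    Fin.comp_snoc (fun y : S.Γinf => y.untopD 0) z c
  rw [values, values, this, Fin.cons_snoc_eq_snoc_cons, Fin.cons_snoc_eq_snoc_cons]

variable {S}

lemma Close.mono {m M : ℕ} (h : m ≤ M) {x x' : Fin 2 → S.K} (H : S.Close M x x') :
    S.Close m x x' where
  zero_eq := H.zero_eq
  pos := H.pos
  ne_top := H.ne_top
  lt := (nsmul_le_nsmul_left H.pos.le h).trans_lt H.lt
  lt' := (nsmul_le_nsmul_left H.pos.le h).trans_lt H.lt'
  one_ne_top := H.one_ne_top
  one_ne_top' := H.one_ne_top'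
  ac_eq := H.ac_eq

lemma Close.symm {m : ℕ} {x x' : Fin 2 → S.K} (H : S.Close m x x') : S.Close m x' x where
  zero_eq := H.zero_eq.symm
  pos := H.zero_eq ▸ H.pos
  ne_top := H.zero_eq ▸ H.ne_top
  lt := H.zero_eq ▸ H.lt'
  lt' := H.zero_eq ▸ H.lt
  one_ne_top := H.one_ne_top'
  one_ne_top' := H.one_ne_top
  ac_eq := H.ac_eq.symm

/-- The two points are close and the tuples `z`, `z'` are similar over them. -/
structure SimOver (m : ℕ) (x x' : Fin 2 → S.K) {l : ℕ} (z z' : Fin l → S.Γinf) : Prop where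
  close : S.Close m x x'
  top_iff : ∀ i, z i = ⊤ ↔ z' i = ⊤
  sim : Sim S.one m (S.values x z) (S.values x' z')

lemma SimOver.mono {m M : ℕ} (h : m ≤ M) {x x' : Fin 2 → S.K} {l : ℕ} {z z' : Fin l → S.Γinf}
    (H : SimOver M x x' z z') : SimOver m x x' z z' :=
  ⟨H.close.mono h, H.top_iff, H.sim.mono h⟩

lemma SimOver.symm {m : ℕ} {x x' : Fin 2 → S.K} {l : ℕ} {z z' : Fin l → S.Γinf}
    (H : SimOver m x x' z z') : SimOver m x' x z' z :=
  ⟨H.close.symm, fun i => (H.top_iff i).symm, H.sim.symm⟩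

/-- Similarity extends to one more variable of the value group sort. -/
lemma exists_simOver_snoc (hΓ : IsPresburger S.Γ S.one) (m : ℕ) :
    ∃ M, ∀ {x x' : Fin 2 → S.K} {l : ℕ} {z z' : Fin l → S.Γinf}, SimOver M x x' z z' →
      ∀ c, ∃ c', SimOver m x x' (Fin.snoc z c : Fin (l + 1) → S.Γinf) (Fin.snoc z' c') := by
  obtain ⟨M, hM⟩ := hΓ.exists_snoc m
  refine ⟨max m M, fun {x x' l z z'} H c => ?_⟩
  induction c using WithTop.recTopCoe with
  | top =>
    refine ⟨⊤, H.close.mono (le_max_left _ _), fun i => ?_, ?_⟩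
    · induction i using Fin.lastCases with
      | last => simp
      | cast i => simpa using H.top_iff i
    · rw [values_snoc, values_snoc, WithTop.untopD_top]
      exact (H.sim.mono (le_max_left _ _)).snoc_zero
  | coe c =>
    obtain ⟨c', hc'⟩ := hM (H.sim.mono (le_max_right _ _)) c
    refine ⟨c', H.close.mono (le_max_left _ _), fun i => ?_, ?_⟩
    · induction i using Fin.lastCases with
      | last => simp
      | cast i => simpa using H.top_iff i
    · rw [values_snoc, values_snoc, WithTop.untopD_coe, WithTop.untopD_coe]
      exact hc'

/-- Terms of the residue field sort take the same values at close points. -/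
lemma rTerm_eval_eq (hk : CharZero S.k) {j : ℕ} (t : RTerm 2 j) :
    ∃ N, ∀ {x x' : Fin 2 → S.K}, S.Close N x x' → ∀ y, t.eval S x' y = t.eval S x y := by
  induction t with
  | var a => exact ⟨0, fun _ _ => rfl⟩
  | zero => exact ⟨0, fun _ _ => rfl⟩
  | one => exact ⟨0, fun _ _ => rfl⟩
  | add s t hs ht =>
    obtain ⟨M, hM⟩ := hs
    obtain ⟨N, hN⟩ := ht
    refine ⟨max M N, fun H y => ?_⟩
    rw [RTerm.eval, RTerm.eval, hM (H.mono (le_max_left _ _)), hN (H.mono (le_max_right _ _))]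
  | mul s t hs ht =>
    obtain ⟨M, hM⟩ := hs
    obtain ⟨N, hN⟩ := ht
    refine ⟨max M N, fun H y => ?_⟩
    rw [RTerm.eval, RTerm.eval, hM (H.mono (le_max_left _ _)), hN (H.mono (le_max_right _ _))]
  | neg s hs =>
    obtain ⟨M, hM⟩ := hs
    exact ⟨M, fun H y => by rw [RTerm.eval, RTerm.eval, hM H]⟩
  | ac t =>
    rcases S.eval_eq_zero_or hk t with h | ⟨r, m, c, h⟩
    · exact ⟨0, fun _ y => by rw [RTerm.eval, RTerm.eval, h, h]⟩
    · refine ⟨r, fun H y => ?_⟩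
      rw [RTerm.eval, RTerm.eval, (h _ H.pos H.lt).2, (h _ H.symm.pos H.symm.lt).2, H.zero_eq,
        H.ac_eq]

/-- Terms of the value group sort are `∞` or given by an affine form. -/
lemma gTerm_eval_eq (hk : CharZero S.k) {l : ℕ} (t : GTerm 2 l) :
    ∃ (N : ℕ) (c : Fin (l + 1 + 1) → ℤ) (d : ℤ), (∀ i, |c i| ≤ N) ∧ |d| ≤ N ∧
      ∀ {x x' : Fin 2 → S.K} {z z' : Fin l → S.Γinf}, S.Close N x x' →
        (∀ i, z i = ⊤ ↔ z' i = ⊤) →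
        (t.eval S x z = ⊤ ∧ t.eval S x' z' = ⊤) ∨
        (t.eval S x z = affine S.one c d (S.values x z) ∧
          t.eval S x' z' = affine S.one c d (S.values x' z')) := by
  induction t with
  | var a =>
    refine ⟨1, Pi.single a.succ.succ 1, 0, fun i => ?_, by simp, fun {x x' z z'} _ h => ?_⟩
    · rw [Pi.single_apply]; split_ifs <;> simp
    · simp only [GTerm.eval, affine_single, values, Fin.cons_succ]
      by_cases ha : z a = ⊤
      · exact Or.inl ⟨ha, (h a).1 ha⟩
      · exact Or.inr ⟨eq_coe_untopD ha,
          eq_coe_untopD fun h' => ha ((h a).2 h')⟩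
  | zero => exact ⟨0, 0, 0, by simp, by simp, fun _ _ => Or.inr (by simp [GTerm.eval, affine_zero])⟩
  | one => exact ⟨1, 0, 1, by simp, by simp, fun _ _ => Or.inr (by simp [GTerm.eval, affine])⟩
  | infty => exact ⟨0, 0, 0, by simp, by simp, fun _ _ => Or.inl (by simp [GTerm.eval])⟩
  | add s t hs ht =>
    obtain ⟨M, c, d, hc, hd, hM⟩ := hs
    obtain ⟨N, c', d', hc', hd', hN⟩ := ht
    refine ⟨M + N, c + c', d + d', fun i => ?_, ?_, fun H hz => ?_⟩
    · have := hc i; have := hc' i; have := abs_add_le (c i) (c' i)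
      simp only [Pi.add_apply]; lia
    · have := abs_add_le d d'; lia
    · rw [GTerm.eval, GTerm.eval, affine_add, affine_add]
      rcases hM (H.mono (Nat.le_add_right _ _)) hz with ⟨h1, h2⟩ | ⟨h1, h2⟩
      · left; rw [h1, h2]; simp
      · rcases hN (H.mono (Nat.le_add_left _ _)) hz with ⟨h3, h4⟩ | ⟨h3, h4⟩
        · left; rw [h3, h4]; simp
        · right; rw [h1, h2, h3, h4]; simp
  | v t =>
    rcases S.eval_eq_zero_or hk t with h | ⟨r, m, c, h⟩
    · refine ⟨0, 0, 0, by simp, by simp, fun _ _ => Or.inl ?_⟩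
      rw [GTerm.eval, GTerm.eval, h, h, S.v.map_zero]; exact ⟨rfl, rfl⟩
    · have key : ∀ (x : Fin 2 → S.K) (z : Fin l → S.Γinf), S.v (x 0) ≠ ⊤ → S.v (x 1) ≠ ⊤ →
          r • S.v (x 0) + m • S.v (x 1) =
            affine S.one (Fin.cons r (Fin.cons m 0 : Fin (l + 1) → ℤ)) 0 (S.values x z) := by
        intro x z h0 h1
        obtain ⟨a, ha⟩ := WithTop.ne_top_iff_exists.1 h0
        obtain ⟨b, hb⟩ := WithTop.ne_top_iff_exists.1 h1
        rw [affine, Fin.sum_univ_succ, Fin.sum_univ_succ]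
        simp [values, ← ha, ← hb]
      refine ⟨r + m, Fin.cons r (Fin.cons m 0 : Fin (l + 1) → ℤ), 0, fun i => ?_, ?_,
        fun H hz => Or.inr ?_⟩
      · induction i using Fin.cases with
        | zero => simp
        | succ i =>
          induction i using Fin.cases with
          | zero => simp
          | succ i => simp; positivity
      · simp; positivity
      · have H' := H.mono (Nat.le_add_right r m)
        rw [GTerm.eval, GTerm.eval, (h _ H'.pos H'.lt).1, (h _ H'.symm.pos H'.symm.lt).1]
        exact ⟨key _ _ H.ne_top H.one_ne_top, key _ _ H.symm.ne_top H.one_ne_top'⟩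

/-- Simple formulas do not separate similar tuples. -/
theorem realize_iff_of_isSimple (hk : CharZero S.k) (hΓ : IsPresburger S.Γ S.one) {i j l : ℕ}
    (φ : Formula i j l) (hφ : φ.IsSimple) (hi : 2 = i) :
    ∃ N, ∀ {x x' : Fin i → S.K} {z z' : Fin l → S.Γinf},
      SimOver N (x ∘ Fin.cast hi) (x' ∘ Fin.cast hi) z z' →
      ∀ y, φ.Realize S x y z ↔ φ.Realize S x' y z' := by
  induction φ with
  | falsum => exact ⟨0, fun _ _ => Iff.rfl⟩
  | eqK s t =>
    subst hi
    simp only [Fin.cast_refl, Function.comp_id]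
    have key : ∀ s t : KTerm 2, ∀ x : Fin 2 → S.K,
        s.eval S x = t.eval S x ↔ (s.add t.neg).eval S x = 0 := fun s t x => by
      rw [KTerm.eval, KTerm.eval, ← sub_eq_add_neg, sub_eq_zero]
    rcases S.eval_eq_zero_or hk (s.add t.neg) with h | ⟨r, m, c, h⟩
    · exact ⟨0, fun H _ => by simp [Formula.Realize, key, h]⟩
    -- At close points the difference has the finite value of a monomial, so the equation fails at
    -- both.
    · refine ⟨r, fun H _ => ?_⟩
      rw [Formula.Realize, Formula.Realize, key, key, ← S.v_eq_top_iff, ← S.v_eq_top_iff,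
        (h _ H.close.pos H.close.lt).1, (h _ H.close.symm.pos H.close.symm.lt).1]
      have := H.close
      obtain ⟨a, ha⟩ := WithTop.ne_top_iff_exists.1 this.ne_top
      obtain ⟨b, hb⟩ := WithTop.ne_top_iff_exists.1 this.one_ne_top
      obtain ⟨b', hb'⟩ := WithTop.ne_top_iff_exists.1 this.one_ne_top'
      rw [this.zero_eq, ← ha, ← hb, ← hb']
      norm_cast
      exact iff_of_false WithTop.coe_ne_top WithTop.coe_ne_top
  | eqR s t =>
    subst hi
    simp only [Fin.cast_refl, Function.comp_id]
    obtain ⟨M, hM⟩ := rTerm_eval_eq hk s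
    obtain ⟨N, hN⟩ := rTerm_eval_eq hk t
    refine ⟨max M N, fun H y => ?_⟩
    rw [Formula.Realize, Formula.Realize, hM (H.close.mono (le_max_left _ _)),
      hN (H.close.mono (le_max_right _ _))]
  | eqG s t =>
    subst hi
    simp only [Fin.cast_refl, Function.comp_id]
    obtain ⟨M, c, d, hc, hd, hM⟩ := gTerm_eval_eq hk s
    obtain ⟨N, c', d', hc', hd', hN⟩ := gTerm_eval_eq hk t
    refine ⟨M + N, fun H y => ?_⟩
    have h0 := H.sim.eq_iff le_rfl hc hd hc' hd'
    rw [Formula.Realize, Formula.Realize]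
    rcases hM (H.close.mono (Nat.le_add_right _ _)) H.top_iff with ⟨h1, h2⟩ | ⟨h1, h2⟩ <;>
    rcases hN (H.close.mono (Nat.le_add_left _ _)) H.top_iff with ⟨h3, h4⟩ | ⟨h3, h4⟩ <;>
    rw [h1, h2, h3, h4]
    · simp
    · simp
    · exact_mod_cast h0
  | lt s t =>
    subst hi
    simp only [Fin.cast_refl, Function.comp_id]
    obtain ⟨M, c, d, hc, hd, hM⟩ := gTerm_eval_eq hk s
    obtain ⟨N, c', d', hc', hd', hN⟩ := gTerm_eval_eq hk t
    refine ⟨M + N, fun H y => ?_⟩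
    have h0 := H.sim.lt_iff le_rfl hc hd hc' hd'
    rw [Formula.Realize, Formula.Realize]
    rcases hM (H.close.mono (Nat.le_add_right _ _)) H.top_iff with ⟨h1, h2⟩ | ⟨h1, h2⟩ <;>
    rcases hN (H.close.mono (Nat.le_add_left _ _)) H.top_iff with ⟨h3, h4⟩ | ⟨h3, h4⟩ <;>
    rw [h1, h2, h3, h4]
    · simp
    · simp
    · exact_mod_cast h0
  | dvd n hn s =>
    subst hi
    simp only [Fin.cast_refl, Function.comp_id]
    obtain ⟨M, c, d, hc, hd, hM⟩ := gTerm_eval_eq hk s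
    -- With this bound `n` divides the factorial `(M + n)!`, so the congruence in the similarity
    -- decides divisibility by `n`.
    refine ⟨M + n, fun H y => ?_⟩
    rw [Formula.Realize, Formula.Realize]
    rcases hM (H.close.mono (Nat.le_add_right _ _)) H.top_iff with ⟨h1, h2⟩ | ⟨h1, h2⟩ <;>
    rw [h1, h2]
    rw [coe_dvd_iff hn, coe_dvd_iff hn]
    obtain ⟨b, hb⟩ := affine_congr (e := S.one) _ c d H.sim.congr
    obtain ⟨k, hk⟩ := Nat.dvd_factorial (by lia) (Nat.le_add_left n M)
    rw [hk, mul_smul] at hb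
    constructor
    · rintro ⟨b', hb'⟩
      exact ⟨b' - k • b, by rw [smul_sub, ← hb, ← hb', sub_sub_cancel]⟩
    · rintro ⟨b', hb'⟩
      exact ⟨b' + k • b, by rw [smul_add, ← hb, ← hb', add_sub_cancel]⟩
  | imp φ ψ h1 h2 =>
    obtain ⟨M, hM⟩ := h1 hφ.1 hi
    obtain ⟨N, hN⟩ := h2 hφ.2 hi
    exact ⟨max M N, fun H y => imp_congr (hM (H.mono (le_max_left _ _)) y)
      (hN (H.mono (le_max_right _ _)) y)⟩
  | allK φ _ => exact hφ.elim
  | allR φ h =>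
    obtain ⟨N, hN⟩ := h hφ hi
    exact ⟨N, fun H y => forall_congr' fun b => hN H _⟩
  | allG φ h =>
    obtain ⟨N, hN⟩ := h hφ hi
    obtain ⟨M, hM⟩ := exists_simOver_snoc hΓ N
    have key : ∀ {x x' : Fin _ → S.K} {z z' : Fin _ → S.Γinf},
        SimOver M (x ∘ Fin.cast hi) (x' ∘ Fin.cast hi) z z' → ∀ y,
        φ.allG.Realize S x y z → φ.allG.Realize S x' y z' := fun {x x' z z'} H y h0 c' => by
      -- A challenge `c'` on the primed side is pulled back to some `c`, where the hypothesis
      -- applies.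
      obtain ⟨c, hc⟩ := hM H.symm c'
      exact (hN hc.symm y).1 (h0 c)
    exact ⟨M, fun H y => ⟨key H y, key H.symm y⟩⟩

end PasStructure

namespace PasStructure
variable {S : PasStructure.{u, w}}

/-! ### The gap type is not isolated -/

lemma realize_not {i j l : ℕ} {φ : Formula i j l} {x : Fin i → S.K} {y : Fin j → S.k}
    {z : Fin l → S.Γinf} : φ.not.Realize S x y z ↔ ¬ φ.Realize S x y z := Iff.rfl

lemma realize_and {i j l : ℕ} {φ ψ : Formula i j l} {x : Fin i → S.K} {y : Fin j → S.k}
    {z : Fin l → S.Γinf} :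
    (φ.and ψ).Realize S x y z ↔ φ.Realize S x y z ∧ ψ.Realize S x y z := by
  simp only [Formula.and, realize_not, Formula.Realize]; tauto

lemma eval_pow {i : ℕ} (t : KTerm i) (n : ℕ) (x : Fin i → S.K) :
    (t.pow n).eval S x = t.eval S x ^ n := by
  induction n with
  | zero => rw [KTerm.pow, pow_zero, KTerm.eval]
  | succ n ih => rw [KTerm.pow, pow_succ, KTerm.eval, ih]

lemma realize_gapFormula {n : ℕ} {x : Fin 2 → S.K} {y : Fin 0 → S.k} {z : Fin 0 → S.Γinf} :
    (gapFormula n).Realize S x y z ↔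
      0 < n • S.v (x 0) ∧ n • S.v (x 0) < S.v (x 1) ∧ x 1 ≠ 0 := by
  simp only [gapFormula, realize_and, realize_not, Formula.Realize, GTerm.eval, eval_pow,
    KTerm.eval, S.v.map_pow, and_assoc, Ne]

/-- As `e ≤ p`, the part of a bounded form without `q` has absolute value at most `2m • p`, less
than `q`. So the sign of the form is the sign of the coefficient of `q`, unless that coefficient
vanishes and `q` does not occur. -/
lemma sim_pair {e p q q' : S.Γ} (he : 0 < e) (hp : e ≤ p) {m : ℕ} (hq : (2 * m) • p < q)
    (hq' : (2 * m) • p < q') (h : ∃ b : S.Γ, q - q' = m.factorial • b) (r : Fin 0 → S.Γ) :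
    Sim e m (Fin.cons p (Fin.cons q r : Fin 1 → S.Γ)) (Fin.cons p (Fin.cons q' r : Fin 1 → S.Γ))
    where
  pos_iff c d hc hd := by
    have aff : ∀ q : S.Γ, affine e c d (Fin.cons p (Fin.cons q r : Fin 1 → S.Γ)) =
        (c 0 • p + d • e) + c 1 • q := fun q => by
      simp [affine, Fin.sum_univ_succ]; abel
    have hp0 : 0 < p := he.trans_le hp
    have hm : ∀ z : ℤ, |z| ≤ m → ∀ y : S.Γ, 0 ≤ y → y ≤ p → |z • y| ≤ m • p := fun z hz y h0 h1 => by
      rw [abs_zsmul, abs_of_nonneg h0, ← natCast_zsmul]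
      exact (zsmul_le_zsmul_left h0 hz).trans (zsmul_le_zsmul_right (Int.natCast_nonneg m) h1)
    have hbound : |c 0 • p + d • e| ≤ (2 * m) • p := by
      refine (abs_add_le _ _).trans ?_
      rw [two_mul, add_smul]
      exact add_le_add (hm _ (hc 0) p hp0.le le_rfl) (hm _ hd e he.le hp)
    obtain ⟨hb1, hb2⟩ := abs_le.1 hbound
    rw [aff, aff]
    rcases lt_trichotomy (c 1) 0 with h0 | h0 | h0
    · have neg : ∀ q : S.Γ, (2 * m) • p < q → ¬ 0 < (c 0 • p + d • e) + c 1 • q := fun q hq => by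
        have hq0 : 0 ≤ q := (nsmul_nonneg hp0.le _).trans hq.le
        have : c 1 • q ≤ (-1 : ℤ) • q := zsmul_le_zsmul_left hq0 (by lia)
        rw [neg_one_zsmul] at this
        exact not_lt.2 ((add_le_add (hb2.trans hq.le) this).trans (add_neg_cancel q).le)
      exact iff_of_false (neg q hq) (neg q' hq')
    · rw [h0, zero_smul, zero_smul]
    · have pos : ∀ q : S.Γ, (2 * m) • p < q → 0 < (c 0 • p + d • e) + c 1 • q := fun q hq => by
        have hq0 : 0 ≤ q := (nsmul_nonneg hp0.le _).trans hq.le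
        have : (1 : ℤ) • q ≤ c 1 • q := zsmul_le_zsmul_left hq0 (by lia)
        rw [one_zsmul] at this
        calc 0 = -((2 * m) • p) + (2 * m) • p := (neg_add_cancel _).symm
          _ < (c 0 • p + d • e) + c 1 • q := add_lt_add_of_le_of_lt hb1 (hq.trans_le this)
      exact iff_of_true (pos q hq) (pos q' hq')
  congr i := by
    induction i using Fin.cases with
    | zero => exact ⟨0, by simp⟩
    | succ i =>
      induction i using Fin.cases with
      | zero => simpa using h
      | succ i => exact i.elim0

theorem not_isIsolated_gapType (hk : CharZero S.k) (hΓ : IsPresburger S.Γ S.one)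
    (hQE : S.AdmitsQEInFieldSort) : ¬ S.IsIsolated gapType := by
  rintro ⟨φ, ⟨x, y, z, hxyz⟩, hφ⟩
  obtain ⟨ψ, hψ, hφψ⟩ := hQE 2 0 0 φ
  obtain ⟨m, hm⟩ := realize_iff_of_isSimple hk hΓ ψ hψ rfl
  simp only [Fin.cast_refl, Function.comp_id] at hm
  have gap : ∀ n, 1 ≤ n → 0 < n • S.v (x 0) ∧ n • S.v (x 0) < S.v (x 1) ∧ x 1 ≠ 0 := fun n hn =>
    realize_gapFormula.1 (hφ _ ⟨n, hn, rfl⟩ x y z hxyz)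
  have h1 := gap 1 le_rfl
  rw [one_smul] at h1
  obtain ⟨p, hp⟩ := WithTop.ne_top_iff_exists.1 h1.2.1.ne_top
  obtain ⟨q, hq⟩ := WithTop.ne_top_iff_exists.1 (S.v_eq_top_iff.not.2 h1.2.2)
  rw [← hp, ← hq] at h1
  have hp0 : 0 < p := by exact_mod_cast h1.1
  have hep : S.one ≤ p := not_lt.1 (hΓ.least p hp0)
  have gap' : ∀ n : ℕ, n • p < q := fun n => by
    have := (gap (n + 1) (Nat.le_add_left 1 n)).2.1
    rw [← hp, ← hq] at this
    exact (nsmul_le_nsmul_left hp0.le n.le_succ).trans_lt (by exact_mod_cast this)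
  -- The new value `q'` is congruent to `q` modulo `m!`. It exceeds `2m • p`, as similarity
  -- requires, but is at most `(2m + 1 + r) • p`, which will violate one formula of the gap type.
  obtain ⟨r, hr, b, hb⟩ := hΓ.exists_div m.factorial_pos (q - (2 * m + 1) • p)
  set q' : S.Γ := (2 * m + 1) • p + r • S.one with hq'
  have hre : 0 ≤ r • S.one := nsmul_nonneg hΓ.pos.le r
  have hlow : (2 * m) • p < q' :=
    (nsmul_lt_nsmul_left hp0 (Nat.lt_succ_self _)).trans_le (le_add_of_nonneg_right hre)
  have hup : q' ≤ (2 * m + 1 + r) • p := by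
    rw [add_smul _ r]
    exact add_le_add_right (nsmul_le_nsmul_right hep r) _
  obtain ⟨y₁, hy₁, hac⟩ := S.exists_v_ac q' (S.ac_ne_zero h1.2.2)
  have hmp : ∀ t : S.Γ, (2 * m) • p < t → m • (p : WithTop S.Γ) < t := fun t ht => by
    exact_mod_cast (nsmul_le_nsmul_left hp0.le (by lia : m ≤ 2 * m)).trans_lt ht
  have close : S.Close m x ![x 0, y₁] :=
    { zero_eq := rfl
      pos := by rw [← hp]; exact h1.1
      ne_top := by rw [← hp]; exact WithTop.coe_ne_top
      lt := by rw [← hp, ← hq]; exact hmp _ (gap' _)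
      lt' := by rw [← hp]; simp only [Matrix.cons_val_one, Matrix.cons_val_fin_one, hy₁]; exact hmp _ hlow
      one_ne_top := by rw [← hq]; exact WithTop.coe_ne_top
      one_ne_top' := by simp [hy₁]
      ac_eq := hac }
  have sim : SimOver m x ![x 0, y₁] z z := by
    refine ⟨close, fun _ => Iff.rfl, ?_⟩
    have := sim_pair hΓ.pos hep (gap' _) hlow ⟨b, ?_⟩ (fun i => (z i).untopD 0)
    · simpa only [values, ← hp, ← hq, Matrix.cons_val_zero, Matrix.cons_val_one,
        Matrix.cons_val_fin_one, hy₁, WithTop.untopD_coe] using this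
    · rw [hq', ← sub_sub, hb, add_sub_cancel_right]
  have hnew : φ.Realize S ![x 0, y₁] y z := (hφψ _ _ _).2 ((hm sim y).1 ((hφψ _ _ _).1 hxyz))
  have := (realize_gapFormula.1 (hφ _ ⟨2 * m + 1 + r, by lia, rfl⟩ _ _ _ hnew)).2.1
  simp only [Matrix.cons_val_zero, Matrix.cons_val_one, Matrix.cons_val_fin_one, hy₁, ← hp] at this
  exact absurd hup (not_le.2 (by exact_mod_cast this))

end PasStructure

/-! ### Substitution -/

/-- Renaming of variables. -/
def KTerm.rename {i i' : ℕ} (σ : Fin i → Fin i') : KTerm i → KTerm i'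
  | .var a => .var (σ a)
  | .zero => .zero
  | .one => .one
  | .add s t => .add (s.rename σ) (t.rename σ)
  | .neg s => .neg (s.rename σ)
  | .mul s t => .mul (s.rename σ) (t.rename σ)

/-- Renaming of the variables of the field sort and substitution of terms of the residue field
sort. -/
def RTerm.subst {i j i' j' : ℕ} (σ : Fin i → Fin i') (ρ : Fin j → RTerm i' j') :
    RTerm i j → RTerm i' j'
  | .var a => ρ a
  | .zero => .zero
  | .one => .one
  | .add s t => .add (s.subst σ ρ) (t.subst σ ρ)
  | .neg s => .neg (s.subst σ ρ)
  | .mul s t => .mul (s.subst σ ρ) (t.subst σ ρ)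
  | .ac s => .ac (s.rename σ)

/-- Renaming of the variables of the field sort and substitution of terms of the value group
sort. -/
def GTerm.subst {i l i' l' : ℕ} (σ : Fin i → Fin i') (τ : Fin l → GTerm i' l') :
    GTerm i l → GTerm i' l'
  | .var a => τ a
  | .zero => .zero
  | .one => .one
  | .infty => .infty
  | .add s t => .add (s.subst σ τ) (t.subst σ τ)
  | .v s => .v (s.rename σ)

/-- Renaming of the variables of the field sort and substitution of terms of the other sorts. -/
def Formula.subst : {i j l : ℕ} → Formula i j l → {i' j' l' : ℕ} → (Fin i → Fin i') →
    (Fin j → RTerm i' j') → (Fin l → GTerm i' l') → Formula i' j' l'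
  | _, _, _, .falsum, _, _, _, _, _, _ => .falsum
  | _, _, _, .eqK s t, _, _, _, σ, _, _ => .eqK (s.rename σ) (t.rename σ)
  | _, _, _, .eqR s t, _, _, _, σ, ρ, _ => .eqR (s.subst σ ρ) (t.subst σ ρ)
  | _, _, _, .eqG s t, _, _, _, σ, _, τ => .eqG (s.subst σ τ) (t.subst σ τ)
  | _, _, _, .lt s t, _, _, _, σ, _, τ => .lt (s.subst σ τ) (t.subst σ τ)
  | _, _, _, .dvd n hn s, _, _, _, σ, _, τ => .dvd n hn (s.subst σ τ)
  | _, _, _, .imp φ ψ, _, _, _, σ, ρ, τ => .imp (φ.subst σ ρ τ) (ψ.subst σ ρ τ)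
  | i, _, _, .allK φ, i', _, _, σ, ρ, τ => .allK (φ.subst
      (Fin.snoc (Fin.castSucc ∘ σ) (Fin.last i') : Fin (i + 1) → Fin (i' + 1))
      (fun k => (ρ k).subst Fin.castSucc .var) (fun k => (τ k).subst Fin.castSucc .var))
  | _, j, _, .allR φ, i', j', _, σ, ρ, τ => .allR (φ.subst σ
      (Fin.snoc (fun k => (ρ k).subst id (.var ∘ Fin.castSucc)) (.var (Fin.last j')) :
        Fin (j + 1) → RTerm i' (j' + 1)) τ)
  | _, _, l, .allG φ, i', _, l', σ, ρ, τ => .allG (φ.subst σ ρ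
      (Fin.snoc (fun k => (τ k).subst id (.var ∘ Fin.castSucc)) (.var (Fin.last l')) :
        Fin (l + 1) → GTerm i' (l' + 1)))

namespace PasStructure
variable {S : PasStructure.{u, w}}

lemma eval_rename {i i' : ℕ} (σ : Fin i → Fin i') (t : KTerm i) (x : Fin i' → S.K) :
    (t.rename σ).eval S x = t.eval S (x ∘ σ) := by
  induction t with
  | var a => rfl
  | zero => rfl
  | one => rfl
  | add s t hs ht => rw [KTerm.rename, KTerm.eval, KTerm.eval, hs, ht]
  | mul s t hs ht => rw [KTerm.rename, KTerm.eval, KTerm.eval, hs, ht]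
  | neg s hs => rw [KTerm.rename, KTerm.eval, KTerm.eval, hs]

lemma eval_rSubst {i j i' j' : ℕ} (σ : Fin i → Fin i') (ρ : Fin j → RTerm i' j') (t : RTerm i j)
    (x : Fin i' → S.K) (y : Fin j' → S.k) :
    (t.subst σ ρ).eval S x y = t.eval S (x ∘ σ) (fun k => (ρ k).eval S x y) := by
  induction t with
  | var a => rfl
  | zero => rfl
  | one => rfl
  | add s t hs ht => rw [RTerm.subst, RTerm.eval, RTerm.eval, hs, ht]
  | mul s t hs ht => rw [RTerm.subst, RTerm.eval, RTerm.eval, hs, ht]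
  | neg s hs => rw [RTerm.subst, RTerm.eval, RTerm.eval, hs]
  | ac s => rw [RTerm.subst, RTerm.eval, RTerm.eval, eval_rename]

lemma eval_gSubst {i l i' l' : ℕ} (σ : Fin i → Fin i') (τ : Fin l → GTerm i' l') (t : GTerm i l)
    (x : Fin i' → S.K) (z : Fin l' → S.Γinf) :
    (t.subst σ τ).eval S x z = t.eval S (x ∘ σ) (fun k => (τ k).eval S x z) := by
  induction t with
  | var a => rfl
  | zero => rfl
  | one => rfl
  | infty => rfl
  | add s t hs ht => rw [GTerm.subst, GTerm.eval, GTerm.eval, hs, ht]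
  | v s => rw [GTerm.subst, GTerm.eval, GTerm.eval, eval_rename]

lemma realize_subst {i j l : ℕ} (φ : Formula i j l) {i' j' l' : ℕ} (σ : Fin i → Fin i')
    (ρ : Fin j → RTerm i' j') (τ : Fin l → GTerm i' l') (x : Fin i' → S.K) (y : Fin j' → S.k)
    (z : Fin l' → S.Γinf) :
    (φ.subst σ ρ τ).Realize S x y z ↔
      φ.Realize S (x ∘ σ) (fun k => (ρ k).eval S x y) (fun k => (τ k).eval S x z) := by
  induction φ generalizing i' j' l' with
  | falsum => rfl
  | eqK s t => simp only [Formula.subst, Formula.Realize, eval_rename]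
  | eqR s t => simp only [Formula.subst, Formula.Realize, eval_rSubst]
  | eqG s t => simp only [Formula.subst, Formula.Realize, eval_gSubst]
  | lt s t => simp only [Formula.subst, Formula.Realize, eval_gSubst]
  | dvd n hn s => simp only [Formula.subst, Formula.Realize, eval_gSubst]
  | imp φ ψ h1 h2 => simp only [Formula.subst, Formula.Realize, h1, h2]
  | allK φ h =>
    simp only [Formula.subst, Formula.Realize, h, eval_rSubst, eval_gSubst]
    refine forall_congr' fun a => ?_
    rw [Fin.comp_snoc, Fin.snoc_last, ← Function.comp_assoc, Fin.snoc_comp_castSucc]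
    rfl
  | allR φ h =>
    simp only [Formula.subst, Formula.Realize, h]
    refine forall_congr' fun b => ?_
    have : (fun k => RTerm.eval S x (Fin.snoc y b) ((Fin.snoc
        (fun k => (ρ k).subst id (.var ∘ Fin.castSucc)) (.var (Fin.last j')) :
          Fin (_ + 1) → RTerm i' (j' + 1)) k)) =
        (Fin.snoc (fun k => (ρ k).eval S x y) b : Fin (_ + 1) → S.k) := by
      funext k
      induction k using Fin.lastCases with
      | last => simp [RTerm.eval]
      | cast k => simp [eval_rSubst, RTerm.eval]
    rw [this]
  | allG φ h =>
    simp only [Formula.subst, Formula.Realize, h]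
    refine forall_congr' fun b => ?_
    have : (fun k => GTerm.eval S x (Fin.snoc z b) ((Fin.snoc
        (fun k => (τ k).subst id (.var ∘ Fin.castSucc)) (.var (Fin.last l')) :
          Fin (_ + 1) → GTerm i' (l' + 1)) k)) =
        (Fin.snoc (fun k => (τ k).eval S x z) b : Fin (_ + 1) → S.Γinf) := by
      funext k
      induction k using Fin.lastCases with
      | last => simp [GTerm.eval]
      | cast k => simp [eval_gSubst, GTerm.eval]
    rw [this]

end PasStructure

/-! ### The language is countable -/

/-- Code of a term. -/
def KTerm.code {i : ℕ} : KTerm i → ℕ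
  | .var a => Nat.pair 0 a
  | .zero => Nat.pair 1 0
  | .one => Nat.pair 2 0
  | .add s t => Nat.pair 3 (Nat.pair s.code t.code)
  | .neg s => Nat.pair 4 s.code
  | .mul s t => Nat.pair 5 (Nat.pair s.code t.code)

/-- Code of a term. -/
def RTerm.code {i j : ℕ} : RTerm i j → ℕ
  | .var a => Nat.pair 0 a
  | .zero => Nat.pair 1 0
  | .one => Nat.pair 2 0
  | .add s t => Nat.pair 3 (Nat.pair s.code t.code)
  | .neg s => Nat.pair 4 s.code
  | .mul s t => Nat.pair 5 (Nat.pair s.code t.code)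
  | .ac s => Nat.pair 6 s.code

/-- Code of a term. -/
def GTerm.code {i l : ℕ} : GTerm i l → ℕ
  | .var a => Nat.pair 0 a
  | .zero => Nat.pair 1 0
  | .one => Nat.pair 2 0
  | .infty => Nat.pair 3 0
  | .add s t => Nat.pair 4 (Nat.pair s.code t.code)
  | .v s => Nat.pair 5 s.code

/-- Code of a formula. -/
def Formula.code : {i j l : ℕ} → Formula i j l → ℕ
  | _, _, _, .falsum => Nat.pair 0 0
  | _, _, _, .eqK s t => Nat.pair 1 (Nat.pair s.code t.code)
  | _, _, _, .eqR s t => Nat.pair 2 (Nat.pair s.code t.code)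
  | _, _, _, .eqG s t => Nat.pair 3 (Nat.pair s.code t.code)
  | _, _, _, .lt s t => Nat.pair 4 (Nat.pair s.code t.code)
  | _, _, _, .dvd n _ s => Nat.pair 5 (Nat.pair n s.code)
  | _, _, _, .imp φ ψ => Nat.pair 6 (Nat.pair φ.code ψ.code)
  | _, _, _, .allK φ => Nat.pair 7 φ.code
  | _, _, _, .allR φ => Nat.pair 8 φ.code
  | _, _, _, .allG φ => Nat.pair 9 φ.code

lemma KTerm.code_injective {i : ℕ} : Function.Injective (KTerm.code (i := i)) := by
  intro s
  induction s with
  | var a => intro t h; cases t <;> simp_all [KTerm.code, Nat.pair_eq_pair, Fin.ext_iff]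
  | zero | one => intro t h; cases t <;> simp_all [KTerm.code, Nat.pair_eq_pair]
  | add s t hs ht | mul s t hs ht =>
    intro t' h
    cases t' <;> simp [KTerm.code, Nat.pair_eq_pair] at h ⊢
    exact ⟨hs h.1, ht h.2⟩
  | neg s hs =>
    intro t' h
    cases t' <;> simp [KTerm.code, Nat.pair_eq_pair] at h ⊢
    exact hs h

lemma RTerm.code_injective {i j : ℕ} : Function.Injective (RTerm.code (i := i) (j := j)) := by
  intro s
  induction s with
  | var a => intro t h; cases t <;> simp_all [RTerm.code, Nat.pair_eq_pair, Fin.ext_iff]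
  | zero | one => intro t h; cases t <;> simp_all [RTerm.code, Nat.pair_eq_pair]
  | add s t hs ht | mul s t hs ht =>
    intro t' h
    cases t' <;> simp [RTerm.code, Nat.pair_eq_pair] at h ⊢
    exact ⟨hs h.1, ht h.2⟩
  | neg s hs =>
    intro t' h
    cases t' <;> simp [RTerm.code, Nat.pair_eq_pair] at h ⊢
    exact hs h
  | ac s =>
    intro t' h
    cases t' <;> simp_all [RTerm.code, Nat.pair_eq_pair, KTerm.code_injective.eq_iff]

lemma GTerm.code_injective {i l : ℕ} : Function.Injective (GTerm.code (i := i) (l := l)) := by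
  intro s
  induction s with
  | var a => intro t h; cases t <;> simp_all [GTerm.code, Nat.pair_eq_pair, Fin.ext_iff]
  | zero | one | infty => intro t h; cases t <;> simp_all [GTerm.code, Nat.pair_eq_pair]
  | add s t hs ht =>
    intro t' h
    cases t' <;> simp [GTerm.code, Nat.pair_eq_pair] at h ⊢
    exact ⟨hs h.1, ht h.2⟩
  | v s =>
    intro t' h
    cases t' <;> simp_all [GTerm.code, Nat.pair_eq_pair, KTerm.code_injective.eq_iff]

lemma Formula.code_injective {i j l : ℕ} (φ ψ : Formula i j l) (h : φ.code = ψ.code) :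
    φ = ψ := by
  induction φ with
  | falsum => cases ψ <;> simp_all [Formula.code, Nat.pair_eq_pair]
  | eqK s t =>
    cases ψ <;> simp_all [Formula.code, Nat.pair_eq_pair, KTerm.code_injective.eq_iff]
  | eqR s t =>
    cases ψ <;> simp_all [Formula.code, Nat.pair_eq_pair, RTerm.code_injective.eq_iff]
  | eqG s t | lt s t | dvd n hn s =>
    cases ψ <;> simp_all [Formula.code, Nat.pair_eq_pair, GTerm.code_injective.eq_iff]
  | imp φ φ' h1 h2 =>
    cases ψ <;> simp [Formula.code, Nat.pair_eq_pair] at h ⊢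
    exact ⟨h1 _ h.1, h2 _ h.2⟩
  | allK φ h1 | allR φ h1 | allG φ h1 =>
    cases ψ <;> simp [Formula.code, Nat.pair_eq_pair] at h ⊢
    exact h1 _ h

instance {i j l : ℕ} : Countable (Formula i j l) :=
  Function.Injective.countable (f := Formula.code) fun φ ψ => Formula.code_injective φ ψ

namespace PasStructure
variable {S : PasStructure.{u, w}}

/-! ### Definable sets of sequences -/

/-- A set of sequences is definable if it is given by a formula in finitely many coordinates. -/
def Definable (S : PasStructure.{u, w}) (A : Set (ℕ → S.K)) : Prop :=
  ∃ (i : ℕ) (φ : Formula i 0 0) (e : Fin i → ℕ), A = {x | φ.Realize S (x ∘ e) ![] ![]}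

/-- Countability allows a generic filter to meet all the relevant dense sets, whatever the
cardinality of `S`. -/
lemma countable_definable : Countable {A : Set (ℕ → S.K) // S.Definable A} := by
  have : Function.Surjective (fun d : (Σ i, Formula i 0 0 × (Fin i → ℕ)) =>
      (⟨{x | d.2.1.Realize S (x ∘ d.2.2) ![] ![]}, _, _, _, rfl⟩ :
        {A : Set (ℕ → S.K) // S.Definable A})) := by
    rintro ⟨A, i, φ, e, rfl⟩
    exact ⟨⟨i, φ, e⟩, rfl⟩
  exact this.countable

/-- Parameters of the other two sorts are named as `ac` and `v` of coordinates, so sequences in the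
field sort suffice. -/
lemma definable_realize {i j l : ℕ} (φ : Formula i j l) (e : Fin i → ℕ) (f : Fin j → ℕ)
    (g : Fin l → ℕ) : S.Definable
      {x | φ.Realize S (x ∘ e) (fun k => S.ac (x (f k))) (fun k => S.v (x (g k)))} := by
  refine ⟨i + j + l, φ.subst (Fin.castAdd l ∘ Fin.castAdd j)
    (fun k => .ac (.var (Fin.castAdd l (Fin.natAdd i k))))
    (fun k => .v (.var (Fin.natAdd (i + j) k))), Fin.append (Fin.append e f) g, ?_⟩
  ext x
  simp only [Set.mem_ofPred_eq, realize_subst, RTerm.eval, GTerm.eval, KTerm.eval,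
    Function.comp_apply, Fin.append_left, Fin.append_right]
  have : (x ∘ Fin.append (Fin.append e f) g) ∘ Fin.castAdd l ∘ Fin.castAdd j = x ∘ e := by
    funext k; simp
  rw [this]

lemma definable_setOf {A : Set (ℕ → S.K)} {i : ℕ} (φ : Formula i 0 0) (e : Fin i → ℕ)
    (h : ∀ x, x ∈ A ↔ φ.Realize S (x ∘ e) ![] ![]) : S.Definable A :=
  ⟨i, φ, e, Set.ext h⟩

namespace Definable
variable {A B : Set (ℕ → S.K)}

lemma imp (hA : S.Definable A) (hB : S.Definable B) : S.Definable {x | x ∈ A → x ∈ B} := by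
  obtain ⟨i, φ, e, rfl⟩ := hA
  obtain ⟨j, ψ, f, rfl⟩ := hB
  refine ⟨i + j, (φ.subst (Fin.castAdd j) Fin.elim0 Fin.elim0).imp
    (ψ.subst (Fin.natAdd i) Fin.elim0 Fin.elim0), Fin.append e f, ?_⟩
  ext x
  simp only [Set.mem_ofPred_eq, Formula.Realize, realize_subst]
  have h1 : (x ∘ Fin.append e f) ∘ Fin.castAdd j = x ∘ e := by funext k; simp
  have h2 : (x ∘ Fin.append e f) ∘ Fin.natAdd i = x ∘ f := by funext k; simp
  rw [h1, h2]
  refine imp_congr ?_ ?_ <;> exact iff_of_eq (congrArg₂ _ (Subsingleton.elim _ _)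
    (Subsingleton.elim _ _))

lemma compl (hA : S.Definable A) : S.Definable Aᶜ := by
  obtain ⟨i, φ, e, rfl⟩ := hA
  exact ⟨i, φ.not, e, rfl⟩

lemma inter (hA : S.Definable A) (hB : S.Definable B) : S.Definable (A ∩ B) := by
  convert (hA.imp hB.compl).compl
  ext x
  simp

lemma reindex (hA : S.Definable A) (h : ℕ → ℕ) : S.Definable {x | x ∘ h ∈ A} := by
  obtain ⟨i, φ, e, rfl⟩ := hA
  exact ⟨i, φ, h ∘ e, rfl⟩

lemma exists_update (hA : S.Definable A) (n : ℕ) :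
    S.Definable {x | ∃ a, Function.update x n a ∈ A} := by
  obtain ⟨i, φ, e, rfl⟩ := hA
  let φ' : Formula (i + 1) 0 0 := φ.subst
    (fun k => if e k = n then Fin.last i else k.castSucc) Fin.elim0 Fin.elim0
  refine ⟨i, φ'.not.allK.not, e, ?_⟩
  ext x
  simp only [Set.mem_ofPred_eq, realize_not, Formula.Realize, φ', realize_subst, not_forall,
    not_not]
  refine exists_congr fun a => ?_
  have h1 : (Fin.snoc (x ∘ e) a : Fin (i + 1) → S.K) ∘
      (fun k => if e k = n then Fin.last i else k.castSucc) = Function.update x n a ∘ e := by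
    funext k
    by_cases h : e k = n <;> simp [h]
  rw [h1]
  exact iff_of_eq (congrArg₂ _ (Subsingleton.elim _ _) (Subsingleton.elim _ _))

lemma exists_finset (hA : S.Definable A) (F : Finset ℕ) :
    S.Definable {x | ∃ y : ℕ → S.K, (fun n => if n ∈ F then y n else x n) ∈ A} := by
  induction F using Finset.induction_on with
  | empty =>
    convert hA using 1
    ext x
    simp only [Set.mem_ofPred_eq, Finset.notMem_empty, if_false, exists_const]
  | insert a F ha ih =>
    convert ih.exists_update a using 1
    ext x
    simp only [Set.mem_ofPred_eq]
    constructor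
    · rintro ⟨y, hy⟩
      refine ⟨y a, y, ?_⟩
      convert hy using 2 with n
      rcases eq_or_ne n a with rfl | hn
      · simp [ha]
      · simp [hn]
    · rintro ⟨b, y, hy⟩
      refine ⟨Function.update y a b, ?_⟩
      convert hy using 2 with n
      rcases eq_or_ne n a with rfl | hn
      · simp [ha]
      · simp [hn]

lemma exists_support (hA : S.Definable A) : ∃ F : Finset ℕ, ∀ x x' : ℕ → S.K,
    (∀ n ∈ F, x n = x' n) → x ∈ A → x' ∈ A := by
  obtain ⟨i, φ, e, rfl⟩ := hA
  refine ⟨Finset.univ.image e, fun x x' h hx => ?_⟩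
  have : x ∘ e = x' ∘ e := funext fun k => h _ (Finset.mem_image_of_mem _ (Finset.mem_univ k))
  rw [Set.mem_ofPred_eq] at hx ⊢
  rwa [← this]

/-- The projection of a definable set to two coordinates is given by a formula. -/
lemma exists_formula (hA : S.Definable A) {a b : ℕ} (hab : a ≠ b) :
    ∃ ψ : Formula 2 0 0, ∀ (t : Fin 2 → S.K) y z, ψ.Realize S t y z ↔
      ∃ x ∈ A, x a = t 0 ∧ x b = t 1 := by
  obtain ⟨F, hF⟩ := hA.exists_support
  obtain ⟨i, φ, e, h⟩ := hA.exists_finset ((F.erase a).erase b)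
  -- The value `0` away from `a` and `b` is arbitrary: those coordinates are existentially
  -- quantified or lie outside the support of `A`.
  let h' : ℕ → Fin 2 := fun n => if n = b then 1 else 0
  refine ⟨φ.subst (h' ∘ e) Fin.elim0 Fin.elim0, fun t y z => ?_⟩
  have h1 := Set.ext_iff.1 h (t ∘ h')
  simp only [Set.mem_ofPred_eq] at h1
  rw [realize_subst]
  refine (iff_of_eq (congrArg₂ _ (Subsingleton.elim _ _)
    (Subsingleton.elim _ _))).trans (h1.symm.trans ?_)
  constructor
  · rintro ⟨y, hy⟩
    exact ⟨_, hy, by simp [h', hab], by simp [h']⟩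
  · rintro ⟨x, hx, hxa, hxb⟩
    refine ⟨x, hF x _ (fun n hn => ?_) hx⟩
    rcases eq_or_ne n b with rfl | hb
    · simp [h', hxb]
    rcases eq_or_ne n a with rfl | ha
    · simp [h', hxa, hb]
    · simp [ha, hb, hn]

end Definable

/-! ### Generic sequences -/

/-- The integers and `∞` in the value group sort. -/
def ofInt (S : PasStructure.{u, w}) : WithTop (ULift.{w} ℤ) → S.Γinf :=
  WithTop.map fun m => m.down • S.one

lemma definable_v_eq_ofInt (c : ℕ) (m : WithTop (ULift.{w} ℤ)) :
    S.Definable {x | S.v (x c) = S.ofInt m} := by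
  let num : ℕ → GTerm 1 0 := fun n => Nat.rec .zero (fun _ t => .add t .one) n
  have hnum : ∀ n (x : Fin 1 → S.K) z, (num n).eval S x z = (n • S.one : S.Γ) := fun n x z => by
    induction n with
    | zero => simp [num, GTerm.eval]
    | succ n ih =>
      rw [succ_nsmul, WithTop.coe_add, ← ih]
      rfl
  cases m with
  | top =>
    exact definable_setOf (.eqG (.v (.var 0)) .infty) ![c] fun x => by
      simp [Formula.Realize, GTerm.eval, KTerm.eval, ofInt]
  | coe m =>
    obtain ⟨a, b, hab⟩ : ∃ a b : ℕ, m.down = b - a := by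
      obtain ⟨n, h | h⟩ := m.down.eq_nat_or_neg
      · exact ⟨0, n, by simpa using h⟩
      · exact ⟨n, 0, by simpa using h⟩
    refine definable_setOf (.eqG (.add (.v (.var 0)) (num a)) (num b)) ![c] fun x => ?_
    simp only [Formula.Realize, GTerm.eval, KTerm.eval, hnum, ofInt, WithTop.map_coe,
      Set.mem_ofPred_eq, hab, sub_smul, natCast_zsmul, Function.comp_apply, Matrix.cons_val_fin_one]
    generalize S.v (x c) = y
    induction y using WithTop.recTopCoe with
    | top =>
      exact iff_of_false WithTop.top_ne_coe (by rw [WithTop.top_add]; exact WithTop.top_ne_coe)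
    | coe y =>
      norm_cast
      exact eq_sub_iff_add_eq

lemma exists_notMem_ne (F : Finset ℕ) : ∃ a b, a ∉ F ∧ b ∉ F ∧ a ≠ b := by
  obtain ⟨a, ha⟩ := Infinite.exists_notMem_finset F
  obtain ⟨b, hb⟩ := Infinite.exists_notMem_finset (insert a F)
  simp only [Finset.mem_insert, not_or] at hb
  exact ⟨a, b, ha, hb.2, Ne.symm hb.1⟩

/-- If the gap type is not isolated, then every nonempty definable set contains sequences with a
given entry of integral value. -/
lemma exists_v_eq_ofInt (hΓ : IsPresburger S.Γ S.one) (hS : ¬ S.IsIsolated gapType)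
    {A : Set (ℕ → S.K)} (hA : S.Definable A) (hne : A.Nonempty) (c : ℕ) :
    ∃ m, ∃ x ∈ A, S.v (x c) = S.ofInt m := by
  by_contra! h
  apply hS
  obtain ⟨F, hF⟩ := hA.exists_support
  obtain ⟨a, b, ha, hb, hab⟩ := exists_notMem_ne (insert c F)
  simp only [Finset.mem_insert, not_or] at ha hb
  -- Here `x b` is `x c` or its inverse, whichever has positive value, and `x a` has value `1`.
  -- Projecting `A` with these constraints to the coordinates `a, b` gives the isolating formula.
  have hB : S.Definable {x | S.v (x a) = S.one ∧ 0 < S.v (x b) ∧ x b ≠ 0 ∧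
      (x b ≠ x c → x b * x c = 1)} := by
    refine definable_setOf ((Formula.eqG (.v (.var 0)) .one).and ((Formula.lt .zero
      (.v (.var 1))).and ((Formula.eqK (.var 1) .zero).not.and
      ((Formula.eqK (.var 1) (.var 2)).not.imp (.eqK (.mul (.var 1) (.var 2)) .one)))))
      ![a, b, c] fun x => ?_
    simp [realize_and, realize_not, Formula.Realize, GTerm.eval, KTerm.eval]
  obtain ⟨ψ, hψ⟩ := (hA.inter hB).exists_formula hab
  refine ⟨ψ, ?_, ?_⟩
  · obtain ⟨x, hx⟩ := hne
    have hxc : x c ≠ 0 := fun h0 => h ⊤ x hx (by rw [h0, S.v.map_zero]; rfl)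
    obtain ⟨t, ht⟩ := S.v_surjective S.one
    have hex : ∃ s : S.K, 0 < S.v s ∧ s ≠ 0 ∧ (s ≠ x c → s * x c = 1) := by
      rcases lt_trichotomy (S.v (x c)) 0 with h1 | h1 | h1
      · refine ⟨(x c)⁻¹, ?_, inv_ne_zero hxc, fun _ => inv_mul_cancel₀ hxc⟩
        have : S.v (x c) + S.v (x c)⁻¹ = 0 := by
          rw [← S.v.map_mul, mul_inv_cancel₀ hxc, S.v.map_one]
        by_contra! h2
        exact absurd this (add_neg_of_neg_of_nonpos h1 h2).ne
      · exact absurd (h1.trans (by simp [ofInt])) (h ((⟨0⟩ : ULift.{w} ℤ) : WithTop (ULift.{w} ℤ)) x hx)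
      · exact ⟨x c, h1, hxc, fun h => absurd rfl h⟩
    obtain ⟨s, hs⟩ := hex
    refine ⟨![t, s], ![], ![], (hψ _ _ _).2
      ⟨Function.update (Function.update x a t) b s, ⟨hF x _ (fun n hn => ?_) hx, ?_⟩, ?_⟩⟩
    · have h1 : n ≠ a := fun h => ha.2 (h ▸ hn)
      have h2 : n ≠ b := fun h => hb.2 (h ▸ hn)
      simp [h1, h2]
    · simpa [hab, Ne.symm ha.1, Ne.symm hb.1, ht] using hs
    · simp [hab]
  · rintro _ ⟨n, hn, rfl⟩ t y z ht
    obtain ⟨x, ⟨hxA, h1, h2, h3, h4⟩, hx0, hx1⟩ := (hψ _ _ _).1 ht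
    rw [realize_gapFormula, ← hx0, ← hx1, h1]
    obtain ⟨q, hq⟩ := WithTop.ne_top_iff_exists.1 (S.v_eq_top_iff.not.2 h3)
    rw [← hq] at h2 ⊢
    have hq0 : 0 < q := by exact_mod_cast h2
    refine ⟨by exact_mod_cast nsmul_pos hΓ.pos (by lia), ?_, h3⟩
    -- If `v (x b) ≤ n • 1`, then `v (x b)` is a multiple of `1`, so `v (x c)` is that multiple or
    -- its negative, against the assumption on `A`.
    by_contra! h5
    have h6 : q < (n + 1) • S.one := lt_of_le_of_lt (by exact_mod_cast h5)
      (nsmul_lt_nsmul_left hΓ.pos n.lt_succ_self)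
    obtain ⟨r, -, hr⟩ := hΓ.exists_eq_nsmul hq0.le h6
    by_cases hbc : x b = x c
    · refine h ((⟨r⟩ : ULift.{w} ℤ) : WithTop (ULift.{w} ℤ)) x hxA ?_
      rw [← hbc, ← hq, hr]
      simp [ofInt]
    · refine h ((⟨-r⟩ : ULift.{w} ℤ) : WithTop (ULift.{w} ℤ)) x hxA ?_
      have h7 : S.v (x b) + S.v (x c) = 0 := by rw [← S.v.map_mul, h4 hbc, S.v.map_one]
      obtain ⟨s, hs⟩ := WithTop.ne_top_iff_exists.1 fun h : S.v (x c) = ⊤ => by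
        rw [h, WithTop.add_top] at h7; exact WithTop.top_ne_zero h7
      rw [← hq, ← hs] at h7
      rw [← hs]
      have h8 : q + s = 0 := by exact_mod_cast h7
      simp [ofInt, eq_neg_of_add_eq_zero_right h8, hr]

/-- An ultrafilter on the set of sequences in `K` is generic if existential quantifiers over the
field sort are witnessed by entries and if all entries have integral value. -/
structure IsGeneric (U : Ultrafilter (ℕ → S.K)) : Prop where
  witness : ∀ {A : Set (ℕ → S.K)}, S.Definable A → ∀ n, ∃ c, ∀ᶠ x in (U : Filter (ℕ → S.K)),
    (∃ a, Function.update x n a ∈ A) → Function.update x n (x c) ∈ A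
  integral : ∀ c, ∃ m, ∀ᶠ x in (U : Filter (ℕ → S.K)), S.v (x c) = S.ofInt m

/-- Conditions: nonempty definable sets. -/
abbrev Condition (S : PasStructure.{u, w}) :=
  {A : Set (ℕ → S.K) // S.Definable A ∧ A.Nonempty}ᵒᵈ

open Order in
/-- The conditions deciding a witness. -/
def witnessCofinal {A : Set (ℕ → S.K)} (hA : S.Definable A) (n : ℕ) : Cofinal S.Condition where
  carrier := {p | ∃ c, p.ofDual.1 ⊆
    {x | (∃ a, Function.update x n a ∈ A) → Function.update x n (x c) ∈ A}}
  isCofinal p := by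
    obtain ⟨⟨B, hB, x, hx⟩, rfl⟩ := OrderDual.toDual.surjective p
    obtain ⟨F, hF⟩ := hA.exists_support
    obtain ⟨F', hF'⟩ := hB.exists_support
    -- A coordinate on which neither set depends is free to hold the witness.
    obtain ⟨c, hc⟩ := Infinite.exists_notMem_finset (insert n (F ∪ F'))
    simp only [Finset.mem_insert, Finset.mem_union, not_or] at hc
    have h0 : S.Definable {x | Function.update x n (x c) ∈ A} := by
      simpa only [Function.comp_update, Function.comp_id] using
        hA.reindex (Function.update id n c)
    refine ⟨OrderDual.toDual ⟨B ∩ {x | (∃ a, Function.update x n a ∈ A) →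
      Function.update x n (x c) ∈ A}, hB.inter ((hA.exists_update n).imp h0), ?_⟩,
      ⟨c, Set.inter_subset_right⟩, OrderDual.toDual_le_toDual.2 Set.inter_subset_left⟩
    · by_cases h : ∃ a, Function.update x n a ∈ A
      · obtain ⟨a, ha⟩ := h
        refine ⟨Function.update x c a, hF' x _ (fun k hk => ?_) hx, fun _ => ?_⟩
        · rw [Function.update_of_ne (fun h : k = c => hc.2.2 (h ▸ hk))]
        · refine hF _ _ (fun k hk => ?_) ha
          have : k ≠ c := fun h => hc.2.1 (h ▸ hk)
          by_cases hkn : k = n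
          · subst hkn; simp
          · simp [hkn, this]
      · exact ⟨x, hx, fun h' => absurd h' h⟩

open Order in
/-- The conditions deciding the value of an entry. -/
def integralCofinal (hΓ : IsPresburger S.Γ S.one) (hS : ¬ S.IsIsolated gapType) (c : ℕ) :
    Cofinal S.Condition where
  carrier := {p | ∃ m, p.ofDual.1 ⊆ {x | S.v (x c) = S.ofInt m}}
  isCofinal p := by
    obtain ⟨⟨B, hB, hne⟩, rfl⟩ := OrderDual.toDual.surjective p
    obtain ⟨m, x, hx, hm⟩ := exists_v_eq_ofInt hΓ hS hB hne c
    exact ⟨OrderDual.toDual ⟨B ∩ {x | S.v (x c) = S.ofInt m},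
      hB.inter (definable_v_eq_ofInt c m), x, hx, hm⟩,
      ⟨m, Set.inter_subset_right⟩, OrderDual.toDual_le_toDual.2 Set.inter_subset_left⟩

open Filter in
-- The Rasiowa–Sikorski argument: an ideal in the reversed order of conditions meets countably many
-- dense sets. Its sets generate a proper filter, and any ultrafilter above that filter is generic,
-- since each requirement already holds on a member of the filter.
theorem exists_isGeneric (hΓ : IsPresburger S.Γ S.one) (hS : ¬ S.IsIsolated gapType) :
    ∃ U : Ultrafilter (ℕ → S.K), S.IsGeneric U := by
  have := countable_definable (S := S)
  let ι := ({A : Set (ℕ → S.K) // S.Definable A} × ℕ) ⊕ ℕ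
  let : Encodable ι := Encodable.ofCountable ι
  let 𝒟 : ι → Order.Cofinal S.Condition :=
    Sum.elim (fun d => witnessCofinal d.1.2 d.2) (integralCofinal hΓ hS)
  -- The trivial condition: the set of all sequences.
  let p₀ : S.Condition := OrderDual.toDual ⟨{x | x ∈ (∅ : Set _) → x ∈ (∅ : Set _)},
    (definable_setOf (A := ∅) (i := 0) .falsum ![] fun x => Iff.rfl).imp
      (definable_setOf (A := ∅) (i := 0) .falsum ![] fun x => Iff.rfl), 0, fun h => h⟩
  let I := Order.idealOfCofinals p₀ 𝒟
  let F : Filter (ℕ → S.K) := ⨅ p : I, 𝓟 p.1.ofDual.1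
  have hdir : Directed (· ≥ ·) fun p : I => 𝓟 p.1.ofDual.1 := by
    rintro ⟨p, hp⟩ ⟨q, hq⟩
    obtain ⟨r, hr, hpr, hqr⟩ := I.directed p hp q hq
    exact ⟨⟨r, hr⟩, principal_mono.2 hpr, principal_mono.2 hqr⟩
  have : Nonempty I := ⟨⟨p₀, Order.mem_idealOfCofinals _ _⟩⟩
  have hF : F.NeBot := iInf_neBot_of_directed' hdir fun p => principal_neBot_iff.2 p.1.ofDual.2.2
  have hmem : ∀ p ∈ I, ∀ B, p.ofDual.1 ⊆ B → B ∈ (Ultrafilter.of F : Filter (ℕ → S.K)) :=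
    fun p hp B hB => Ultrafilter.of_le F (mem_iInf_of_mem ⟨p, hp⟩ (mem_principal.2 hB))
  refine ⟨Ultrafilter.of F, fun {A} hA n => ?_, fun c => ?_⟩
  · obtain ⟨p, ⟨c, hc⟩, hp⟩ := Order.cofinal_meets_idealOfCofinals p₀ 𝒟 (Sum.inl (⟨A, hA⟩, n))
    exact ⟨c, hmem p hp _ hc⟩
  · obtain ⟨p, ⟨m, hm⟩, hp⟩ := Order.cofinal_meets_idealOfCofinals p₀ 𝒟 (Sum.inr c)
    exact ⟨m, hmem p hp _ hm⟩

end PasStructure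
namespace PasStructure
variable {S : PasStructure.{u, w}}

open Filter

/-! ### The structure of entries of a generic sequence -/

instance : IsOrderedAddMonoid (ULift.{w} ℤ) where
  add_le_add_left a b h c := by
    have h' : a.down ≤ b.down := h
    exact (add_le_add_left h' c.down : a.down + c.down ≤ b.down + c.down)

/-! ### The integers inside the value group -/

lemma ofInt_strictMono (hΓ : IsPresburger S.Γ S.one) : StrictMono S.ofInt := by
  have : StrictMono fun m : ULift.{w} ℤ => m.down • S.one := fun a b h =>
    zsmul_lt_zsmul_left hΓ.pos (h : a.down < b.down)
  exact this.withTop_map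

lemma ofInt_coe (m : ULift.{w} ℤ) : S.ofInt m = (m.down • S.one : S.Γ) := rfl

lemma ofInt_top : S.ofInt ⊤ = ⊤ := rfl

lemma ofInt_zero : S.ofInt 0 = 0 := by
  change ((0 : ℤ) • S.one : S.Γ) = (0 : S.Γinf)
  rw [zero_smul, WithTop.coe_zero]

lemma ofInt_add (m n : WithTop (ULift.{w} ℤ)) : S.ofInt (m + n) = S.ofInt m + S.ofInt n := by
  cases m with
  | top => rw [WithTop.top_add, ofInt_top, WithTop.top_add]
  | coe m =>
    cases n with
    | top => rw [WithTop.add_top, ofInt_top, WithTop.add_top]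
    | coe n =>
      rw [← WithTop.coe_add, ofInt_coe, ofInt_coe, ofInt_coe, ← WithTop.coe_add, ← add_smul]
      rfl

lemma ofInt_nsmul (k : ℕ) (m : WithTop (ULift.{w} ℤ)) : S.ofInt (k • m) = k • S.ofInt m := by
  induction k with
  | zero => rw [zero_smul, zero_smul, ofInt_zero]
  | succ k ih => rw [succ_nsmul, succ_nsmul, ofInt_add, ih]

/-- The integers are pure in `Γ`. A nonzero remainder `r < n` would make `r • 1` a positive multiple
of `n` below `n • 1`, which is impossible as `1` is the least positive element. -/
lemma dvd_ofInt_iff (hΓ : IsPresburger S.Γ S.one) {n : ℕ} (hn : 1 < n)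
    (m : WithTop (ULift.{w} ℤ)) : (∃ y, S.ofInt m = n • y) ↔ ∃ y, m = n • y := by
  constructor
  · rintro ⟨y, hy⟩
    cases m with
    | top => exact ⟨⊤, (nsmul_top_eq hn).symm⟩
    | coe m =>
      obtain ⟨b, hb⟩ := (coe_dvd_iff hn (m.down • S.one)).1 ⟨y, hy⟩
      obtain ⟨r, hr⟩ := Int.eq_ofNat_of_zero_le (Int.emod_nonneg m.down (by lia : (n : ℤ) ≠ 0))
      have hrn : (r : ℤ) < n := hr ▸ Int.emod_lt_of_pos m.down (by lia)
      have hmd : m.down = n * (m.down / n) + r := by rw [← hr, Int.mul_ediv_add_emod]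
      have h1 : r • S.one = n • (b - (m.down / n) • S.one) := by
        rw [smul_sub, ← hb, ← natCast_zsmul (_ • _) n, smul_smul, ← sub_smul, ← natCast_zsmul]
        congr 1; lia
      have h2 : r = 0 := by
        by_contra hr0
        have h3 : 0 < r • S.one := nsmul_pos hΓ.pos hr0
        have h4 : 0 < b - (m.down / n) • S.one := by
          by_contra! h5
          exact absurd (nsmul_nonpos h5 n) (not_le.2 (h1 ▸ h3))
        have h5 := nsmul_le_nsmul_right (not_lt.1 (hΓ.least _ h4)) n
        rw [← h1] at h5
        exact absurd h5 (not_le.2 (nsmul_lt_nsmul_left hΓ.pos (by exact_mod_cast hrn)))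
      refine ⟨((⟨m.down / n⟩ : ULift.{w} ℤ) : WithTop (ULift.{w} ℤ)), ?_⟩
      rw [← WithTop.coe_nsmul]
      congr 1
      refine ULift.down_injective ?_
      have h3 : m.down = n * (m.down / n) := by rw [h2] at hmd; simpa using hmd
      change m.down = n • (m.down / n)
      rw [nsmul_eq_mul]
      exact h3
  · rintro ⟨y, rfl⟩
    exact ⟨S.ofInt y, ofInt_nsmul n y⟩

namespace IsGeneric
variable {U : Ultrafilter (ℕ → S.K)}

/-- Coordinate `n`, on which `P` does not depend, acts as the quantified variable. -/
lemma exists_entry (hU : S.IsGeneric U) {P : (ℕ → S.K) → S.K → Prop} (n : ℕ)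
    (hn : ∀ x a, P (Function.update x n a) a ↔ P x a) (hP : S.Definable {x | P x (x n)})
    (h : ∀ᶠ x in (U : Filter (ℕ → S.K)), ∃ a, P x a) :
    ∃ c, ∀ᶠ x in (U : Filter (ℕ → S.K)), P x (x c) := by
  obtain ⟨c, hc⟩ := hU.witness hP n
  refine ⟨c, ?_⟩
  filter_upwards [h, hc] with x ⟨a, ha⟩ hx
  have h1 : ∀ a, Function.update x n a ∈ {x | P x (x n)} ↔ P x a := fun a => by
    rw [Set.mem_ofPred_eq, Function.update_self, hn]
  exact (h1 _).1 (hx ⟨a, (h1 a).2 ha⟩)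

lemma exists_fresh {i j l : ℕ} (e : Fin i → ℕ) (f : Fin j → ℕ) (g : Fin l → ℕ) :
    ∃ n, ∀ (x : ℕ → S.K) a, Function.update x n a ∘ e = x ∘ e ∧
      (fun m => S.ac (Function.update x n a m)) ∘ f = (fun m => S.ac (x m)) ∘ f ∧
      (fun m => S.v (Function.update x n a m)) ∘ g = (fun m => S.v (x m)) ∘ g := by
  obtain ⟨n, hn⟩ := Infinite.exists_notMem_finset
    (Finset.univ.image e ∪ Finset.univ.image f ∪ Finset.univ.image g)
  simp only [Finset.mem_union, Finset.mem_image, Finset.mem_univ, true_and, not_or,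
    not_exists] at hn
  refine ⟨n, fun x a => ⟨?_, ?_, ?_⟩⟩ <;> funext k
  · simp [Function.update_of_ne (hn.1.1 k)]
  · simp [Function.update_of_ne (hn.1.2 k)]
  · simp [Function.update_of_ne (hn.2 k)]

lemma exists_entryK (hU : S.IsGeneric U) {i j l : ℕ} (φ : Formula (i + 1) j l) (e : Fin i → ℕ)
    (f : Fin j → ℕ) (g : Fin l → ℕ)
    (h : ∀ᶠ x in (U : Filter (ℕ → S.K)), ∃ a, φ.Realize S (Fin.snoc (x ∘ e) a)
      ((fun m => S.ac (x m)) ∘ f) ((fun m => S.v (x m)) ∘ g)) :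
    ∃ c, ∀ᶠ x in (U : Filter (ℕ → S.K)), φ.Realize S (Fin.snoc (x ∘ e) (x c))
      ((fun m => S.ac (x m)) ∘ f) ((fun m => S.v (x m)) ∘ g) := by
  obtain ⟨n, hn⟩ := exists_fresh (S := S) e f g
  refine hU.exists_entry n (fun x a => ?_) ?_ h
  · rw [(hn x a).1, (hn x a).2.1, (hn x a).2.2]
  · simp only [← Fin.comp_snoc]
    exact definable_realize φ (Fin.snoc e n) f g

lemma exists_entryR (hU : S.IsGeneric U) {i j l : ℕ} (φ : Formula i (j + 1) l) (e : Fin i → ℕ)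
    (f : Fin j → ℕ) (g : Fin l → ℕ)
    (h : ∀ᶠ x in (U : Filter (ℕ → S.K)), ∃ a, φ.Realize S (x ∘ e)
      (Fin.snoc ((fun m => S.ac (x m)) ∘ f) a) ((fun m => S.v (x m)) ∘ g)) :
    ∃ c, ∀ᶠ x in (U : Filter (ℕ → S.K)), φ.Realize S (x ∘ e)
      (Fin.snoc ((fun m => S.ac (x m)) ∘ f) (S.ac (x c))) ((fun m => S.v (x m)) ∘ g) := by
  obtain ⟨n, hn⟩ := exists_fresh (S := S) e f g
  refine hU.exists_entry (P := fun x a => φ.Realize S (x ∘ e)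
      (Fin.snoc ((fun m => S.ac (x m)) ∘ f) (S.ac a)) ((fun m => S.v (x m)) ∘ g))
      n (fun x a => ?_) ?_ (h.mono fun x ⟨a, ha⟩ => ?_)
  · rw [(hn x a).1, (hn x a).2.1, (hn x a).2.2]
  · have h1 := definable_realize (S := S) φ e (Fin.snoc f n) g
    have h2 : ∀ x : ℕ → S.K, (Fin.snoc ((fun m => S.ac (x m)) ∘ f) (S.ac (x n)) :
        Fin (j + 1) → S.k) = fun k => S.ac (x ((Fin.snoc f n : Fin (j + 1) → ℕ) k)) := fun x =>
      (Fin.comp_snoc (fun m => S.ac (x m)) f n).symm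
    simp only [h2]
    exact h1
  · obtain ⟨b, rfl⟩ := S.ac_surjective a
    exact ⟨b, ha⟩

lemma exists_entryG (hU : S.IsGeneric U) {i j l : ℕ} (φ : Formula i j (l + 1)) (e : Fin i → ℕ)
    (f : Fin j → ℕ) (g : Fin l → ℕ)
    (h : ∀ᶠ x in (U : Filter (ℕ → S.K)), ∃ a, φ.Realize S (x ∘ e)
      ((fun m => S.ac (x m)) ∘ f) (Fin.snoc ((fun m => S.v (x m)) ∘ g) a)) :
    ∃ c, ∀ᶠ x in (U : Filter (ℕ → S.K)), φ.Realize S (x ∘ e)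
      ((fun m => S.ac (x m)) ∘ f) (Fin.snoc ((fun m => S.v (x m)) ∘ g) (S.v (x c))) := by
  obtain ⟨n, hn⟩ := exists_fresh (S := S) e f g
  refine hU.exists_entry (P := fun x a => φ.Realize S (x ∘ e)
      ((fun m => S.ac (x m)) ∘ f) (Fin.snoc ((fun m => S.v (x m)) ∘ g) (S.v a)))
      n (fun x a => ?_) ?_ (h.mono fun x ⟨a, ha⟩ => ?_)
  · rw [(hn x a).1, (hn x a).2.1, (hn x a).2.2]
  · have h1 := definable_realize (S := S) φ e f (Fin.snoc g n)
    have h2 : ∀ x : ℕ → S.K, (Fin.snoc ((fun m => S.v (x m)) ∘ g) (S.v (x n)) :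
        Fin (l + 1) → S.Γinf) = fun k => S.v (x ((Fin.snoc g n : Fin (l + 1) → ℕ) k)) := fun x =>
      (Fin.comp_snoc (fun m => S.v (x m)) g n).symm
    simp only [h2]
    exact h1
  · obtain ⟨b, rfl⟩ := S.v_surjective' a
    exact ⟨b, ha⟩

/-- Every quantifier-free definable function of two entries is equal to an entry. -/
lemma exists_entry_fun (hU : S.IsGeneric U) (F : S.K → S.K → S.K) (a b : ℕ) (φ : Formula 3 0 0)
    (hφ : ∀ t y z, φ.Realize S t y z ↔ t 0 = F (t 1) (t 2)) :
    ∃ c, ∀ᶠ x in (U : Filter (ℕ → S.K)), x c = F (x a) (x b) := by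
  refine hU.exists_entry (P := fun x y => y = F (x a) (x b)) (a + b + 1) (fun x y => ?_)
    (definable_setOf φ ![a + b + 1, a, b] fun x => by simp [hφ]) (Eventually.of_forall fun x =>
      ⟨_, rfl⟩)
  rw [Function.update_of_ne (by lia), Function.update_of_ne (by lia)]

/-- The field of entries, as a subfield of the ultrapower of `K`. -/
def entryField (hU : S.IsGeneric U) : Subfield (Germ (U : Filter (ℕ → S.K)) S.K) where
  carrier := Set.range fun c : ℕ => ((fun x => x c : (ℕ → S.K) → S.K) : Germ _ _)
  zero_mem' := by
    obtain ⟨c, hc⟩ := hU.exists_entry_fun (fun _ _ => 0) 0 0 (.eqK (.var 0) .zero)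
      fun t y z => Iff.rfl
    exact ⟨c, Germ.coe_eq.2 hc⟩
  one_mem' := by
    obtain ⟨c, hc⟩ := hU.exists_entry_fun (fun _ _ => 1) 0 0 (.eqK (.var 0) .one)
      fun t y z => Iff.rfl
    exact ⟨c, Germ.coe_eq.2 hc⟩
  add_mem' := by
    rintro _ _ ⟨a, rfl⟩ ⟨b, rfl⟩
    obtain ⟨c, hc⟩ := hU.exists_entry_fun (fun s t => s + t) a b
      (.eqK (.var 0) (.add (.var 1) (.var 2))) fun t y z => Iff.rfl
    exact ⟨c, Germ.coe_eq.2 hc⟩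
  mul_mem' := by
    rintro _ _ ⟨a, rfl⟩ ⟨b, rfl⟩
    obtain ⟨c, hc⟩ := hU.exists_entry_fun (fun s t => s * t) a b
      (.eqK (.var 0) (.mul (.var 1) (.var 2))) fun t y z => Iff.rfl
    exact ⟨c, Germ.coe_eq.2 hc⟩
  neg_mem' := by
    rintro _ ⟨a, rfl⟩
    obtain ⟨c, hc⟩ := hU.exists_entry_fun (fun s _ => -s) a a
      (.eqK (.var 0) (.neg (.var 1))) fun t y z => Iff.rfl
    exact ⟨c, Germ.coe_eq.2 hc⟩
  inv_mem' := by
    rintro _ ⟨a, rfl⟩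
    obtain ⟨c, hc⟩ := hU.exists_entry_fun (fun s _ => s⁻¹) a a
      -- The equations `s t s = s` and `t s t = t` characterize `t = s⁻¹` and also cover the
      -- convention `0⁻¹ = 0`.
      ((Formula.eqK (.mul (.mul (.var 1) (.var 0)) (.var 1)) (.var 1)).and
        (.eqK (.mul (.mul (.var 0) (.var 1)) (.var 0)) (.var 0))) fun t y z => by
      simp only [realize_and, Formula.Realize, KTerm.eval]
      constructor
      · rintro ⟨h1, h2⟩
        rcases eq_or_ne (t 1) 0 with h0 | h0
        · rw [h0] at h2 ⊢
          simpa using h2.symm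
        · rw [mul_eq_right₀ h0] at h1
          exact eq_inv_of_mul_eq_one_right h1
      · intro h
        rw [h]
        rcases eq_or_ne (t 1) 0 with h0 | h0 <;> simp [h0]
    exact ⟨c, Germ.coe_eq.2 hc⟩

/-- The entries of a generic sequence, as elements of the field of entries. -/
def entry (hU : S.IsGeneric U) (c : ℕ) : hU.entryField := ⟨_, c, rfl⟩

lemma entry_surjective (hU : S.IsGeneric U) : Function.Surjective hU.entry := by
  rintro ⟨_, c, rfl⟩
  exact ⟨c, rfl⟩

lemma coe_entry (hU : S.IsGeneric U) (c : ℕ) :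
    (hU.entry c : Germ (U : Filter (ℕ → S.K)) S.K) = ((fun x => x c : (ℕ → S.K) → S.K) : Germ _ _) :=
  rfl

lemma coe_eq_coe_entry (hU : S.IsGeneric U) {F : (ℕ → S.K) → S.K} {c : ℕ} :
    (F : Germ (U : Filter (ℕ → S.K)) S.K) = hU.entry c ↔
      ∀ᶠ x in (U : Filter (ℕ → S.K)), F x = x c := Germ.coe_eq

/-- The value of an entry. -/
noncomputable def val (hU : S.IsGeneric U) (f : hU.entryField) : WithTop (ULift.{w} ℤ) :=
  (hU.integral (hU.entry_surjective f).choose).choose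

lemma eventually_val (hU : S.IsGeneric U) (f : hU.entryField) {F : (ℕ → S.K) → S.K}
    (hF : (F : Germ (U : Filter (ℕ → S.K)) S.K) = f) :
    ∀ᶠ x in (U : Filter (ℕ → S.K)), S.v (F x) = S.ofInt (hU.val f) := by
  have h1 := (hU.integral (hU.entry_surjective f).choose).choose_spec
  rw [← (hU.entry_surjective f).choose_spec] at hF
  filter_upwards [h1, hU.coe_eq_coe_entry.1 hF] with x hx hx'
  rw [hx', hx]
  rfl

lemma exists_coe_eq (hU : S.IsGeneric U) (f : hU.entryField) :
    ∃ F : (ℕ → S.K) → S.K, (F : Germ (U : Filter (ℕ → S.K)) S.K) = f := by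
  obtain ⟨c, rfl⟩ := hU.entry_surjective f
  exact ⟨_, rfl⟩

/-- Two large sets meet and `ofInt` is injective, so the value is unique. -/
lemma val_eq_iff (hU : S.IsGeneric U) (hΓ : IsPresburger S.Γ S.one) (f : hU.entryField)
    {F : (ℕ → S.K) → S.K} (hF : (F : Germ (U : Filter (ℕ → S.K)) S.K) = f)
    {m : WithTop (ULift.{w} ℤ)} :
    hU.val f = m ↔ ∀ᶠ x in (U : Filter (ℕ → S.K)), S.v (F x) = S.ofInt m := by
  have h := hU.eventually_val f hF
  constructor
  · rintro rfl
    exact h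
  · intro h'
    obtain ⟨x, h1, h2⟩ := (h.and h').exists
    exact (ofInt_strictMono hΓ).injective (h1.symm.trans h2)

/-- The valuation of the field of entries. -/
noncomputable def valuation (hU : S.IsGeneric U) (hΓ : IsPresburger S.Γ S.one) :
    AddValuation hU.entryField (WithTop (ULift.{w} ℤ)) :=
  AddValuation.of hU.val
    ((hU.val_eq_iff hΓ 0 (F := fun _ => 0) rfl).2 (Eventually.of_forall fun x => S.v.map_zero))
    ((hU.val_eq_iff hΓ 1 (F := fun _ => 1) rfl).2 (Eventually.of_forall fun x => by
      rw [S.v.map_one, ofInt_zero]))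
    (fun f g => by
      obtain ⟨F, hF⟩ := hU.exists_coe_eq f
      obtain ⟨G, hG⟩ := hU.exists_coe_eq g
      -- The three values are constant on a large set, so the inequality can be read off at one
      -- point.
      obtain ⟨x, ⟨h1, h2⟩, h3⟩ := (((hU.eventually_val f hF).and (hU.eventually_val g hG)).and
        (hU.eventually_val (f + g) (F := fun x => F x + G x)
          (by rw [Subfield.coe_add, ← hF, ← hG]; rfl))).exists
      have := S.v.map_add (F x) (G x)
      rw [h1, h2, h3, ← (ofInt_strictMono hΓ).monotone.map_min] at this
      exact (ofInt_strictMono hΓ).le_iff_le.1 this)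
    (fun f g => by
      obtain ⟨F, hF⟩ := hU.exists_coe_eq f
      obtain ⟨G, hG⟩ := hU.exists_coe_eq g
      refine (hU.val_eq_iff hΓ _ (F := fun x => F x * G x)
        (by rw [Subfield.coe_mul, ← hF, ← hG]; rfl)).2 ?_
      filter_upwards [hU.eventually_val f hF, hU.eventually_val g hG] with x h1 h2
      rw [S.v.map_mul, h1, h2, ofInt_add])

lemma valuation_surjective (hU : S.IsGeneric U) (hΓ : IsPresburger S.Γ S.one)
    (m : ULift.{w} ℤ) : ∃ f, hU.valuation hΓ f = m := by
  obtain ⟨y, hy⟩ := S.v_surjective (m.down • S.one)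
  obtain ⟨c, hc⟩ := hU.exists_entry (P := fun _ y => S.v y = S.ofInt (m : WithTop (ULift.{w} ℤ))) 0 (fun _ _ => Iff.rfl)
    (definable_v_eq_ofInt 0 (m : WithTop (ULift.{w} ℤ))) (Eventually.of_forall fun x => ⟨y, hy⟩)
  exact ⟨hU.entry c, (hU.val_eq_iff hΓ _ rfl).2 hc⟩

end IsGeneric

/-! ### Residues and angular components of entries -/

open Classical in
/-- The residue of an element of the valuation ring; `0` for all other elements. -/
noncomputable def res (S : PasStructure.{u, w}) (x : S.K) : S.k :=
  if h : 0 ≤ S.v x then IsLocalRing.residue (valuationRing S.v) ⟨x, h⟩ else 0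

lemma res_of_nonneg {x : S.K} (h : 0 ≤ S.v x) :
    S.res x = IsLocalRing.residue (valuationRing S.v) ⟨x, h⟩ := dif_pos h

lemma res_add {x y : S.K} (hx : 0 ≤ S.v x) (hy : 0 ≤ S.v y) :
    S.res (x + y) = S.res x + S.res y := by
  rw [res_of_nonneg hx, res_of_nonneg hy, res_of_nonneg (S.v.map_le_add hx hy), ← map_add]
  rfl

lemma res_mul {x y : S.K} (hx : 0 ≤ S.v x) (hy : 0 ≤ S.v y) :
    S.res (x * y) = S.res x * S.res y := by
  rw [res_of_nonneg hx, res_of_nonneg hy,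
    res_of_nonneg (by rw [S.v.map_mul]; exact add_nonneg hx hy), ← map_mul]
  rfl

lemma res_one : S.res 1 = 1 := by
  rw [res_of_nonneg (by rw [S.v.map_one]), ← map_one (IsLocalRing.residue (valuationRing S.v))]
  rfl

lemma res_of_pos {x : S.K} (hx : 0 < S.v x) : S.res x = 0 := by
  rw [res_of_nonneg hx.le]
  exact S.residue_eq_zero_iff.2 hx

lemma res_of_eq_zero {x : S.K} (hx : S.v x = 0) : S.res x = S.ac x := by
  rw [res_of_nonneg hx.ge]
  exact (S.ac_eq_residue ⟨x, hx.ge⟩ hx).symm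

namespace IsGeneric
variable {U : Ultrafilter (ℕ → S.K)}

lemma eventually_nonneg (hU : S.IsGeneric U) (hΓ : IsPresburger S.Γ S.one) {f : hU.entryField}
    (hf : f ∈ valuationRing (hU.valuation hΓ)) {F : (ℕ → S.K) → S.K}
    (hF : (F : Germ (U : Filter (ℕ → S.K)) S.K) = f) :
    ∀ᶠ x in (U : Filter (ℕ → S.K)), 0 ≤ S.v (F x) := by
  filter_upwards [hU.eventually_val f hF] with x hx
  rw [hx, ← ofInt_zero]
  exact (ofInt_strictMono hΓ).monotone hf

/-- The residue map on the valuation ring of the field of entries, with values in the ultrapower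
of the residue field. -/
noncomputable def resHom (hU : S.IsGeneric U) (hΓ : IsPresburger S.Γ S.one) :
    valuationRing (hU.valuation hΓ) →+* Germ (U : Filter (ℕ → S.K)) S.k where
  toFun f := Germ.map S.res f.1.1
  map_one' := Germ.coe_eq.2 (Eventually.of_forall fun _ => res_one)
  map_zero' := Germ.coe_eq.2 (Eventually.of_forall fun _ => res_of_pos (by
    change 0 < S.v 0; rw [S.v.map_zero]; exact WithTop.top_pos))
  map_mul' f g := by
    obtain ⟨F, hF⟩ := hU.exists_coe_eq f.1
    obtain ⟨G, hG⟩ := hU.exists_coe_eq g.1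
    have h := (hU.eventually_nonneg hΓ f.2 hF).and (hU.eventually_nonneg hΓ g.2 hG)
    change Germ.map S.res (f.1.1 * g.1.1) = _
    rw [← hF, ← hG]
    exact Germ.coe_eq.2 (h.mono fun x hx => res_mul hx.1 hx.2)
  map_add' f g := by
    obtain ⟨F, hF⟩ := hU.exists_coe_eq f.1
    obtain ⟨G, hG⟩ := hU.exists_coe_eq g.1
    have h := (hU.eventually_nonneg hΓ f.2 hF).and (hU.eventually_nonneg hΓ g.2 hG)
    change Germ.map S.res (f.1.1 + g.1.1) = _
    rw [← hF, ← hG]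
    exact Germ.coe_eq.2 (h.mono fun x hx => res_add hx.1 hx.2)

lemma resHom_apply (hU : S.IsGeneric U) (hΓ : IsPresburger S.Γ S.one)
    (f : valuationRing (hU.valuation hΓ)) {F : (ℕ → S.K) → S.K}
    (hF : (F : Germ (U : Filter (ℕ → S.K)) S.K) = f.1) :
    hU.resHom hΓ f = ((fun x => S.res (F x) : (ℕ → S.K) → S.k) : Germ _ _) := by
  change Germ.map S.res f.1.1 = _
  rw [← hF]
  rfl

/-- A nonunit has positive value, hence positive value at almost every sequence, and its residue is
`0` there. -/
instance isLocalHom_resHom (hU : S.IsGeneric U) (hΓ : IsPresburger S.Γ S.one) :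
    IsLocalHom (hU.resHom hΓ) where
  map_nonunit f hf := by
    rw [isUnit_valuationRing_iff]
    by_contra h
    obtain ⟨F, hF⟩ := hU.exists_coe_eq f.1
    refine hf.ne_zero ?_
    rw [hU.resHom_apply hΓ f hF]
    refine Germ.coe_eq.2 ?_
    filter_upwards [hU.eventually_val f.1 hF] with x hx
    refine res_of_pos ?_
    rw [hx, ← ofInt_zero]
    exact ofInt_strictMono hΓ (lt_of_le_of_ne f.2 (Ne.symm h))

/-- The residue field of the field of entries embeds into the ultrapower of the residue field. -/
noncomputable def resEmb (hU : S.IsGeneric U) (hΓ : IsPresburger S.Γ S.one) :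
    ResidueField (hU.valuation hΓ) →+* Germ (U : Filter (ℕ → S.K)) S.k :=
  IsLocalRing.ResidueField.lift (hU.resHom hΓ)

lemma resEmb_residue (hU : S.IsGeneric U) (hΓ : IsPresburger S.Γ S.one)
    (f : valuationRing (hU.valuation hΓ)) {F : (ℕ → S.K) → S.K}
    (hF : (F : Germ (U : Filter (ℕ → S.K)) S.K) = f.1) :
    hU.resEmb hΓ (IsLocalRing.residue _ f) =
      ((fun x => S.res (F x) : (ℕ → S.K) → S.k) : Germ _ _) := by
  rw [resEmb, IsLocalRing.ResidueField.lift_residue_apply, hU.resHom_apply hΓ f hF]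

/-- For a nonzero entry, genericity provides an entry of value `0` with the same angular component.
Its residue is the required element, so the angular component of the ultrapower restricts to the
residue field of the entries. -/
lemma exists_resEmb_eq (hU : S.IsGeneric U) (hΓ : IsPresburger S.Γ S.one) (f : hU.entryField) :
    ∃ b, hU.resEmb hΓ b = Germ.map S.ac f.1 := by
  obtain ⟨c, rfl⟩ := hU.entry_surjective f
  rcases U.em (fun x => x c = 0) with h | h
  · refine ⟨0, ?_⟩
    rw [map_zero]
    exact Germ.coe_eq.2 (h.mono fun x hx => by simp [hx, ac_zero])
  · obtain ⟨d, hd⟩ := hU.exists_entry (P := fun x y => x c ≠ 0 → S.v y = 0 ∧ S.ac y = S.ac (x c))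
      (c + 1) (fun x y => by rw [Function.update_of_ne (by lia)])
      (definable_setOf ((Formula.eqK (.var 1) .zero).not.imp ((Formula.eqG (.v (.var 0)) .zero).and
        (.eqR (.ac (.var 0)) (.ac (.var 1))))) ![c + 1, c] fun x => by
          simp [realize_and, realize_not, Formula.Realize, GTerm.eval, KTerm.eval, RTerm.eval])
      (h.mono fun x hx => by
        obtain ⟨y, hy⟩ := S.exists_v_ac 0 (S.ac_ne_zero hx)
        exact ⟨y, fun _ => hy⟩)
    have hd' : ∀ᶠ x in (U : Filter (ℕ → S.K)), S.v (x d) = 0 ∧ S.ac (x d) = S.ac (x c) := by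
      filter_upwards [h, hd] with x h1 h2 using h2 h1
    have h0 : hU.valuation hΓ (hU.entry d) = 0 :=
      (hU.val_eq_iff hΓ _ rfl).2 (hd'.mono fun x hx => by rw [hx.1, ofInt_zero])
    refine ⟨IsLocalRing.residue _ ⟨hU.entry d, h0.ge⟩, ?_⟩
    rw [hU.resEmb_residue hΓ ⟨hU.entry d, h0.ge⟩ rfl]
    exact Germ.coe_eq.2 (hd'.mono fun x hx => by
      change S.res (x d) = S.ac (x c)
      rw [res_of_eq_zero hx.1, hx.2])

/-- The angular component map of the field of entries. -/
noncomputable def ac (hU : S.IsGeneric U) (hΓ : IsPresburger S.Γ S.one) (f : hU.entryField) :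
    ResidueField (hU.valuation hΓ) := (hU.exists_resEmb_eq hΓ f).choose

lemma resEmb_ac (hU : S.IsGeneric U) (hΓ : IsPresburger S.Γ S.one) (f : hU.entryField)
    {F : (ℕ → S.K) → S.K} (hF : (F : Germ (U : Filter (ℕ → S.K)) S.K) = f) :
    hU.resEmb hΓ (hU.ac hΓ f) = ((fun x => S.ac (F x) : (ℕ → S.K) → S.k) : Germ _ _) := by
  rw [ac, (hU.exists_resEmb_eq hΓ f).choose_spec, ← hF]
  rfl

lemma isAngularComponent_ac (hU : S.IsGeneric U) (hΓ : IsPresburger S.Γ S.one) :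
    IsAngularComponent (hU.valuation hΓ) (hU.ac hΓ) where
  map_zero := by
    apply (hU.resEmb hΓ).injective
    rw [hU.resEmb_ac hΓ 0 (F := fun _ => 0) rfl, map_zero]
    exact Germ.coe_eq.2 (Eventually.of_forall fun x => S.ac_zero)
  map_units := by
    let F : hU.entryField →* ResidueField (hU.valuation hΓ) :=
      { toFun := hU.ac hΓ
        map_one' := by
          apply (hU.resEmb hΓ).injective
          rw [hU.resEmb_ac hΓ 1 (F := fun _ => 1) rfl, map_one]
          exact Germ.coe_eq.2 (Eventually.of_forall fun x => S.ac_one)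
        map_mul' := fun f g => by
          obtain ⟨F, hF⟩ := hU.exists_coe_eq f
          obtain ⟨G, hG⟩ := hU.exists_coe_eq g
          apply (hU.resEmb hΓ).injective
          rw [hU.resEmb_ac hΓ (f * g) (F := fun x => F x * G x)
            (by rw [Subfield.coe_mul, ← hF, ← hG]; rfl), map_mul, hU.resEmb_ac hΓ f hF,
            hU.resEmb_ac hΓ g hG]
          exact Germ.coe_eq.2 (Eventually.of_forall fun x => S.ac_mul _ _) }
    exact ⟨Units.map F, fun x => rfl⟩
  map_residue a ha := by
    obtain ⟨F, hF⟩ := hU.exists_coe_eq a.1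
    apply (hU.resEmb hΓ).injective
    rw [hU.resEmb_ac hΓ a.1 hF, hU.resEmb_residue hΓ a hF]
    have h0 := (isUnit_valuationRing_iff _).1 ha
    refine Germ.coe_eq.2 ?_
    filter_upwards [(hU.val_eq_iff hΓ a.1 hF).1 h0] with x hx
    rw [res_of_eq_zero (by rw [hx, ofInt_zero])]

/-- The structure of entries of a generic sequence. Its value group is `ℤ`. -/
noncomputable def entryStructure (hU : S.IsGeneric U) (hΓ : IsPresburger S.Γ S.one) :
    PasStructure.{u, w} where
  K := hU.entryField
  Γ := ULift.{w} ℤ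
  v := hU.valuation hΓ
  v_surjective := hU.valuation_surjective hΓ
  ac := hU.ac hΓ
  isAngularComponent := hU.isAngularComponent_ac hΓ
  one := ⟨1⟩

end IsGeneric
end PasStructure
namespace PasStructure
variable {S : PasStructure.{u, w}}

open Filter

namespace IsGeneric
variable {U : Ultrafilter (ℕ → S.K)}

/-! ### The theorem of Łoś for the structure of entries -/

/-- The assignment of entries. -/
def entryK (hU : S.IsGeneric U) (hΓ : IsPresburger S.Γ S.one) (c : ℕ) :
    (hU.entryStructure hΓ).K := hU.entry c

/-- The assignment of angular components of entries. -/
noncomputable def acEntry (hU : S.IsGeneric U) (hΓ : IsPresburger S.Γ S.one) (c : ℕ) :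
    (hU.entryStructure hΓ).k := (hU.entryStructure hΓ).ac (hU.entryK hΓ c)

/-- The assignment of values of entries. -/
noncomputable def valEntry (hU : S.IsGeneric U) (hΓ : IsPresburger S.Γ S.one) (c : ℕ) :
    (hU.entryStructure hΓ).Γinf := (hU.entryStructure hΓ).v (hU.entryK hΓ c)

/-- The embedding of the field of entries into the ultrapower. -/
def toGerm (hU : S.IsGeneric U) (hΓ : IsPresburger S.Γ S.one)
    (a : (hU.entryStructure hΓ).K) : Germ (U : Filter (ℕ → S.K)) S.K :=
  (show hU.entryField from a).1

lemma toGerm_injective (hU : S.IsGeneric U) (hΓ : IsPresburger S.Γ S.one) :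
    Function.Injective (hU.toGerm hΓ) := Subtype.val_injective

lemma eval_entryStructure (hU : S.IsGeneric U) (hΓ : IsPresburger S.Γ S.one) {i : ℕ}
    (t : KTerm i) (e : Fin i → ℕ) :
    ((fun x => t.eval S (x ∘ e) : (ℕ → S.K) → S.K) : Germ (U : Filter (ℕ → S.K)) S.K) =
      hU.toGerm hΓ (t.eval (hU.entryStructure hΓ) (hU.entryK hΓ ∘ e)) := by
  induction t with
  | var a => rfl
  | zero => rfl
  | one => rfl
  | add s t hs ht =>
    refine Eq.trans ?_ (congrArg₂ (· + ·) hs ht)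
    rfl
  | mul s t hs ht =>
    refine Eq.trans ?_ (congrArg₂ (· * ·) hs ht)
    rfl
  | neg s hs =>
    refine Eq.trans ?_ (congrArg (- ·) hs)
    rfl

lemma rEval_entryStructure (hU : S.IsGeneric U) (hΓ : IsPresburger S.Γ S.one) {i j : ℕ}
    (t : RTerm i j) (e : Fin i → ℕ) (f : Fin j → ℕ) :
    hU.resEmb hΓ (t.eval (hU.entryStructure hΓ) (hU.entryK hΓ ∘ e) (hU.acEntry hΓ ∘ f)) =
      ((fun x => t.eval S (x ∘ e) ((fun m => S.ac (x m)) ∘ f) : (ℕ → S.K) → S.k) :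
        Germ (U : Filter (ℕ → S.K)) S.k) := by
  induction t with
  | var a => exact hU.resEmb_ac hΓ _ (hU.coe_entry (f a)).symm
  | zero => exact map_zero _
  | one => exact map_one _
  | add s t hs ht =>
    refine (map_add (hU.resEmb hΓ) _ _).trans ((congrArg₂ (· + ·) hs ht).trans ?_)
    rfl
  | mul s t hs ht =>
    refine (map_mul (hU.resEmb hΓ) _ _).trans ((congrArg₂ (· * ·) hs ht).trans ?_)
    rfl
  | neg s hs =>
    refine (map_neg (hU.resEmb hΓ) _).trans ((congrArg (- ·) hs).trans ?_)
    rfl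
  | ac s => exact hU.resEmb_ac hΓ _ (hU.eval_entryStructure hΓ s e)

lemma gEval_entryStructure (hU : S.IsGeneric U) (hΓ : IsPresburger S.Γ S.one) {i l : ℕ}
    (t : GTerm i l) (e : Fin i → ℕ) (g : Fin l → ℕ) :
    ∀ᶠ x in (U : Filter (ℕ → S.K)), t.eval S (x ∘ e) ((fun m => S.v (x m)) ∘ g) =
      S.ofInt (t.eval (hU.entryStructure hΓ) (hU.entryK hΓ ∘ e) (hU.valEntry hΓ ∘ g)) := by
  induction t with
  | var a => exact hU.eventually_val _ (hU.coe_entry (g a)).symm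
  | zero => exact Eventually.of_forall fun x => ofInt_zero.symm
  | one => exact Eventually.of_forall fun x =>
    (congrArg (WithTop.some (α := S.Γ)) (one_smul ℤ S.one).symm).trans (ofInt_coe ⟨1⟩).symm
  | infty => exact Eventually.of_forall fun x => rfl
  | add s t hs ht =>
    filter_upwards [hs, ht] with x h1 h2
    exact (congrArg₂ (· + ·) h1 h2).trans (ofInt_add _ _).symm
  | v s => exact hU.eventually_val _ (hU.eval_entryStructure hΓ s e)

/-- Field and residue atoms are compared inside ultrapowers. Terms of the value group sort are
constant and integral on a large set, so their atoms hold almost everywhere or almost nowhere.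
Quantifiers use that counterexamples, if they exist on a large set, are given there by a single
entry. -/
theorem realize_entryStructure (hU : S.IsGeneric U) (hΓ : IsPresburger S.Γ S.one) {i j l : ℕ}
    (φ : Formula i j l) (e : Fin i → ℕ) (f : Fin j → ℕ) (g : Fin l → ℕ) :
    φ.Realize (hU.entryStructure hΓ) (hU.entryK hΓ ∘ e) (hU.acEntry hΓ ∘ f) (hU.valEntry hΓ ∘ g) ↔
      ∀ᶠ x in (U : Filter (ℕ → S.K)), φ.Realize S (x ∘ e) ((fun m => S.ac (x m)) ∘ f)
        ((fun m => S.v (x m)) ∘ g) := by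
  induction φ with
  | falsum => simp [Formula.Realize, U.neBot.ne]
  | eqK s t =>
    refine Iff.trans (hU.toGerm_injective hΓ).eq_iff.symm ?_
    rw [← hU.eval_entryStructure hΓ s e, ← hU.eval_entryStructure hΓ t e]
    exact Germ.coe_eq
  | eqR s t =>
    refine Iff.trans (hU.resEmb hΓ).injective.eq_iff.symm ?_
    rw [hU.rEval_entryStructure hΓ s e f, hU.rEval_entryStructure hΓ t e f]
    exact Germ.coe_eq
  | eqG s t =>
    refine Iff.trans ((ofInt_strictMono hΓ).injective.eq_iff.symm.trans eventually_const.symm)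
      (eventually_congr (f := (U : Filter (ℕ → S.K))) ?_)
    filter_upwards [hU.gEval_entryStructure hΓ s e g, hU.gEval_entryStructure hΓ t e g] with x h1 h2
    rw [Formula.Realize, h1, h2]
  | lt s t =>
    refine Iff.trans ((ofInt_strictMono hΓ).lt_iff_lt.symm.trans eventually_const.symm)
      (eventually_congr (f := (U : Filter (ℕ → S.K))) ?_)
    filter_upwards [hU.gEval_entryStructure hΓ s e g, hU.gEval_entryStructure hΓ t e g] with x h1 h2
    rw [Formula.Realize, h1, h2]
  | dvd n hn s =>
    refine Iff.trans ((dvd_ofInt_iff hΓ hn _).symm.trans eventually_const.symm)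
      (eventually_congr (f := (U : Filter (ℕ → S.K))) ?_)
    filter_upwards [hU.gEval_entryStructure hΓ s e g] with x h1
    rw [Formula.Realize, h1]
  | imp φ ψ h1 h2 =>
    simp only [Formula.Realize, h1, h2, Ultrafilter.eventually_imp]
  | allK φ h =>
    simp only [Formula.Realize]
    constructor
    · intro h1
      by_contra h2
      rw [← Ultrafilter.eventually_not] at h2
      -- Counterexamples at almost every sequence are collected into one entry, at which the
      -- hypothesis is then applied.
      obtain ⟨c, hc⟩ := hU.exists_entryK φ.not e f g (h2.mono fun x hx => not_forall.1 hx)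
      have h3 := (h (Fin.snoc e c) f g).1
      rw [Fin.comp_snoc] at h3
      obtain ⟨x, h4, h5⟩ := (hc.and (h3 (h1 (hU.entryK hΓ c)))).exists
      rw [Fin.comp_snoc] at h5
      exact h4 h5
    · intro h1 a
      obtain ⟨c, rfl⟩ := hU.entry_surjective a
      have h2 := (h (Fin.snoc e c) f g).2
      rw [Fin.comp_snoc] at h2
      refine h2 ?_
      filter_upwards [h1] with x hx
      rw [Fin.comp_snoc]
      exact hx _
  | allR φ h =>
    simp only [Formula.Realize]
    constructor
    · intro h1
      by_contra h2
      rw [← Ultrafilter.eventually_not] at h2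
      obtain ⟨c, hc⟩ := hU.exists_entryR φ.not e f g (h2.mono fun x hx => not_forall.1 hx)
      have h3 := (h e (Fin.snoc f c) g).1
      rw [Fin.comp_snoc] at h3
      obtain ⟨x, h4, h5⟩ := (hc.and (h3 (h1 (hU.acEntry hΓ c)))).exists
      rw [Fin.comp_snoc] at h5
      exact h4 h5
    · intro h1 b
      -- Every residue element is the angular component of an entry, so the induction hypothesis
      -- applies to it.
      obtain ⟨a, rfl⟩ := (hU.entryStructure hΓ).ac_surjective b
      obtain ⟨c, rfl⟩ := hU.entry_surjective a
      have h2 := (h e (Fin.snoc f c) g).2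
      rw [Fin.comp_snoc] at h2
      refine h2 ?_
      filter_upwards [h1] with x hx
      rw [Fin.comp_snoc]
      exact hx _
  | allG φ h =>
    simp only [Formula.Realize]
    constructor
    · intro h1
      by_contra h2
      rw [← Ultrafilter.eventually_not] at h2
      obtain ⟨c, hc⟩ := hU.exists_entryG φ.not e f g (h2.mono fun x hx => not_forall.1 hx)
      have h3 := (h e f (Fin.snoc g c)).1
      rw [Fin.comp_snoc] at h3
      obtain ⟨x, h4, h5⟩ := (hc.and (h3 (h1 (hU.valEntry hΓ c)))).exists
      rw [Fin.comp_snoc] at h5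
      exact h4 h5
    · intro h1 b
      obtain ⟨a, rfl⟩ := (hU.entryStructure hΓ).v_surjective' b
      obtain ⟨c, rfl⟩ := hU.entry_surjective a
      have h2 := (h e f (Fin.snoc g c)).2
      rw [Fin.comp_snoc] at h2
      refine h2 ?_
      filter_upwards [h1] with x hx
      rw [Fin.comp_snoc]
      exact hx _

lemma elementarilyEquivalent (hU : S.IsGeneric U) (hΓ : IsPresburger S.Γ S.one) :
    (hU.entryStructure hΓ).ElementarilyEquivalent S := fun φ => by
  have h := hU.realize_entryStructure hΓ φ ![] ![] ![]
  rw [Matrix.empty_eq (hU.entryK hΓ ∘ ![]), Matrix.empty_eq (hU.acEntry hΓ ∘ ![]),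
    Matrix.empty_eq (hU.valEntry hΓ ∘ ![])] at h
  refine h.trans (Iff.trans (eventually_congr (Eventually.of_forall fun x => ?_)) eventually_const)
  rw [Matrix.empty_eq (x ∘ ![]), Matrix.empty_eq (_ ∘ ![]), Matrix.empty_eq (_ ∘ ![])]

end IsGeneric

end PasStructure

/-! ### The integers have rank one -/

lemma isRankOne_ulift_int : IsRankOne (ULift.{w} ℤ) := by
  have hpos : (0 : ULift.{w} ℤ) < ⟨1⟩ := (by exact one_pos : (0 : ℤ) < 1)
  have hle : ∀ b : ULift.{w} ℤ, 0 < b → (⟨1⟩ : ULift.{w} ℤ) ≤ b := fun b hb =>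
    (by exact Int.add_one_le_of_lt hb : (1 : ℤ) ≤ b.down)
  have hsmul : ∀ b : ULift.{w} ℤ, b = b.down • ⟨1⟩ := fun b => ULift.down_injective (by simp)
  ext H
  simp only [Set.mem_ofPred_eq, Set.mem_singleton_iff]
  constructor
  · rintro ⟨h1, h2⟩
    rw [AddSubgroup.eq_bot_iff_forall]
    by_contra! h3
    obtain ⟨b, hb, hb0⟩ := h3
    -- By convexity, a positive element of `H` brings in the generator `1`.
    have key : ∀ c : ULift.{w} ℤ, c ∈ H → 0 < c → H = ⊤ := fun c hc hc0 => by
      rw [AddSubgroup.eq_top_iff']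
      intro d
      rw [hsmul d]
      exact H.zsmul_mem (h1 _ _ hc hpos.le (hle c hc0)) _
    rcases lt_or_gt_of_ne hb0 with h | h
    · exact h2 (key (-b) (H.neg_mem hb) (neg_pos.2 h))
    · exact h2 (key b hb h)
  · rintro rfl
    refine ⟨fun a b hb h0 h1 => ?_, fun h => ?_⟩
    · rw [AddSubgroup.mem_bot] at hb ⊢
      exact le_antisymm (hb ▸ h1) h0
    · have : (⟨1⟩ : ULift.{w} ℤ) ∈ (⊥ : AddSubgroup (ULift.{w} ℤ)) := h ▸ AddSubgroup.mem_top _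
      exact hpos.ne' (AddSubgroup.mem_bot.1 this)

end Pas

theorem theorem2 (S : Pas.PasStructure.{u, w}) (hK : CharZero S.K) (hk : CharZero S.k)
    (hΓ : Pas.IsZGroup S.Γ S.one) (hQE : S.AdmitsQEInFieldSort) :
    ¬ S.IsIsolated Pas.gapType ∧
      ∃ S₁ : Pas.PasStructure.{u, w}, S₁.ElementarilyEquivalent S ∧ Pas.IsRankOne S₁.Γ := by
  have hΓ' := hΓ.isPresburger
  have h := Pas.PasStructure.not_isIsolated_gapType hk hΓ' hQE
  obtain ⟨U, hU⟩ := Pas.PasStructure.exists_isGeneric hΓ' h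
  exact ⟨h, hU.entryStructure hΓ', hU.elementarilyEquivalent hΓ', Pas.isRankOne_ulift_int⟩
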